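/- Let $k_1,\dots,k_r$ be positive integers, $n=k_1+\dots+k_r$, let $\beta_1,\dots,\beta_r$ be distinct real numbers and let $B=\mathrm{diag}(b_1,\dots,b_n)=\mathrm{diag}(\beta_1,\dots,\beta_1,\dots,\beta_r,\dots,\beta_r)$, where $\beta_i$ occurs $k_i$ times. Equip $\mathfrak{so}(n)$ with the scalar product $\langle X,Y\rangle=-\frac12\mathrm{tr}(XY)$ and with the Lie–Poisson bracket $\{f,g\}(M)=-\langle M,[\nabla f(M),\nabla g(M)]\rangle$. For $A=\mathrm{diag}(a_1,\dots,a_n)$ let $\mathfrak{so}(n)_A=\{X\in\mathfrak{so}(n)\mid [X,A]=0\}$ (with the analogous scalar product and bracket), let $\mathfrak{so}(n)=\mathfrak{so}(n)_A\oplus\mathfrak v$ be the orthogonal decomposition, $M=M_{\mathfrak{so}(n)_A}+M_{\mathfrak v}$, and let $\mathcal L_A=\{\mathrm{tr}(M+\lambda A)^k\mid k=1,\dots,n,\ \lambda\in\mathbb R\}$. Functions on $\mathfrak{so}(n)_A$ are regarded as functions on $\mathfrak{so}(n)$ through $M\mapsto M_{\mathfrak{so}(n)_A}$; $\mathcal S_A$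 is the set of linear functions on $\mathfrak{so}(n)_A$, and $\mathcal F+\mathcal G$ denotes the union of two sets of functions. Let $\mathfrak g$ be $\mathfrak{so}(n)$ or $\mathfrak{so}(n)_A$, with bivector $\Lambda_M(\xi,\eta)=-\langle M,[\xi,\eta]\rangle$, and let $\mathrm{corank}$ be the minimum over $M\in\mathfrak g$ of $\dim\ker\Lambda_M$. A set $\mathcal F$ of smooth functions on $\mathfrak g$ that is closed under the bracket is *complete* if there are $f_1,\dots,f_l\in\mathcal F$ and an integer $d$ such that, for all $M$ in an open dense set, the gradients $\nabla f_i(M)$ are linearly independent and span $F_M=\mathrm{span}\{\nabla f(M)\mid f\in\mathcal F\}$, $\dim\ker(\Lambda_M|_{F_M})=d$, and $l+d=\dim\mathfrak g+\mathrm{corank}$. A set of pairwise commuting smooth functions is a *complete commuting set* if it contains $l=\frac12(\dim\mathfrak g+\mathrm{corank})$ functions whose differentials are linearly independent on an open dense set. A Hamiltonian system is *completely integrable in the noncommutative sense* (respectively, *Liouville integrable*) if it has a complete (respectively, complete commuting) set of first integrals. (i) Suppose $b_i+b_j\ne0$ for $i\ne j$. The $SO(k_1)\times\dots\times SO(k_r)$-symmetric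 rigid body system $\dot M=[M,\Omega]$, $\Omega_{ij}=M_{ij}/(b_i+b_j)$, on $\mathfrak{so}(n)$ is Hamiltonian and completely integrable in the noncommutative sense, with the complete set of integrals $\mathcal L_A+\mathcal S_A$, where $A=B^2$. (ii) Let $\alpha_1,\dots,\alpha_r$ be distinct real numbers, $A=\mathrm{diag}(\alpha_1,\dots,\alpha_1,\dots,\alpha_r,\dots,\alpha_r)$ with $\alpha_i$ occurring $k_i$ times, and let $\mathfrak B$ be a positive definite operator on $\mathfrak{so}(n)_A$ such that the operator $\mathfrak A(M)=\mathrm{ad}_A^{-1}\mathrm{ad}_B(M_{\mathfrak v})+\mathfrak B(M_{\mathfrak{so}(n)_A})$ on $\mathfrak{so}(n)$ is positive definite. If the system $\dot N=[N,\mathfrak B(N)]$ on $\mathfrak{so}(n)_A$ is Liouville integrable with a complete commuting set of integrals $\mathcal S^0$, then the singular Manakov flow $\dot M=[M,\mathfrak A(M)]$ on $\mathfrak{so}(n)$ is Liouville integrable with the complete commuting set of integrals $\mathcal L_A+\mathcal S^0$. -/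

import Mathlib

open Matrix LieAlgebra.Orthogonal

-- The matrix commutator, and a norm on matrices (all norms are equivalent here: the norm only
-- serves to speak of derivatives, smooth functions, open and dense sets).
attribute [local instance 100] LieRing.ofAssociativeRing
attribute [local instance] Matrix.normedAddCommGroup Matrix.normedSpace

namespace Manakov

noncomputable section

/-! ### Lie–Poisson structures on Lie algebras of skew-symmetric matrices -/

/-- Lie subalgebras of the Lie algebra `so n ℝ` of real skew-symmetric matrices. -/
class SkewSubalgebra {n : ℕ} (𝔤 : LieSubalgebra ℝ (Matrix (Fin n) (Fin n) ℝ)) : Prop where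
  le_so : 𝔤 ≤ so (Fin n) ℝ

instance instSkewSo (n : ℕ) : SkewSubalgebra (so (Fin n) ℝ) := ⟨le_refl _⟩

section LiePoisson

variable {n : ℕ} {𝔤 : LieSubalgebra ℝ (Matrix (Fin n) (Fin n) ℝ)}

/-- The scalar product `⟨X, Y⟩ = -½ tr (X Y)`. -/
def form (𝔤 : LieSubalgebra ℝ (Matrix (Fin n) (Fin n) ℝ)) : LinearMap.BilinForm ℝ 𝔤 :=
  LinearMap.mk₂ ℝ (fun X Y => -(1 / 2 : ℝ) * trace (X.1 * Y.1))
    (fun X X' Y => by simp [add_mul, mul_add])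
    (fun c X Y => by simp; ring)
    (fun X Y Y' => by simp [mul_add])
    (fun c X Y => by simp; ring)

theorem form_apply (X Y : 𝔤) : form 𝔤 X Y = -(1 / 2 : ℝ) * trace (X.1 * Y.1) := rfl

theorem form_symm (X Y : 𝔤) : form 𝔤 X Y = form 𝔤 Y X := by
  rw [form_apply, form_apply, trace_mul_comm]

theorem form_self [h : SkewSubalgebra 𝔤] (X : 𝔤) :
    form 𝔤 X X = (1 / 2 : ℝ) * ∑ i, ∑ j, X.1 i j ^ 2 := by
  have hX : X.1ᵀ = -X.1 := (mem_so (Fin n) ℝ X.1).1 (h.le_so X.2)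
  have hij : ∀ i j, X.1 j i = -X.1 i j := fun i j => congrFun (congrFun hX i) j
  rw [form_apply, trace, neg_mul, ← mul_neg, ← Finset.sum_neg_distrib]
  congr 1
  refine Finset.sum_congr rfl fun i _ => ?_
  rw [diag_apply, mul_apply, ← Finset.sum_neg_distrib]
  refine Finset.sum_congr rfl fun j _ => ?_
  rw [hij i j]; ring

theorem form_nondegenerate [SkewSubalgebra 𝔤] : (form 𝔤).Nondegenerate := by
  have key : ∀ X : 𝔤, form 𝔤 X X = 0 → X = 0 := by
    intro X hX
    rw [form_self] at hX
    have h0 : ∑ i, ∑ j, X.1 i j ^ 2 = 0 := by linarith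
    have h1 := (Finset.sum_eq_zero_iff_of_nonneg
      (fun i _ => Finset.sum_nonneg fun j _ => sq_nonneg (X.1 i j))).1 h0
    apply Subtype.ext
    ext i j
    have h2 := (Finset.sum_eq_zero_iff_of_nonneg
      (fun j _ => sq_nonneg (X.1 i j))).1 (h1 i (Finset.mem_univ _)) j (Finset.mem_univ _)
    simpa using h2
  exact ⟨fun X hX => key X (hX X), fun X hX => key X (hX X)⟩

/-- The gradient `∇ f (M)` with respect to the scalar product:
`⟨∇ f (M), Y⟩ = d f (M) Y` for all `Y`. -/
def grad [SkewSubalgebra 𝔤] (f : 𝔤 → ℝ) (M : 𝔤) : 𝔤 :=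
  ((form 𝔤).toDual form_nondegenerate).symm (fderiv ℝ f M).toLinearMap

theorem form_grad [SkewSubalgebra 𝔤] (f : 𝔤 → ℝ) (M Y : 𝔤) :
    form 𝔤 (grad f M) Y = fderiv ℝ f M Y := by
  rw [grad, LinearMap.BilinForm.apply_toDual_symm_apply]
  rfl

/-- The Lie–Poisson bivector at `M`, covectors being identified with elements of `𝔤`:
`Λ_M (ξ, η) = -⟨M, [ξ, η]⟩`. -/
def bivector (M : 𝔤) : LinearMap.BilinForm ℝ 𝔤 :=
  LinearMap.mk₂ ℝ (fun ξ η => -form 𝔤 M ⁅ξ, η⁆)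
    (fun ξ ξ' η => by rw [add_lie, map_add, neg_add])
    (fun c ξ η => by rw [smul_lie, map_smul, smul_neg])
    (fun ξ η η' => by rw [lie_add, map_add, neg_add])
    (fun c ξ η => by rw [lie_smul, map_smul, smul_neg])

/-- The Lie–Poisson bracket `{f, g}(M) = -⟨M, [∇ f (M), ∇ g (M)]⟩`. -/
def poisson [SkewSubalgebra 𝔤] (f g : 𝔤 → ℝ) (M : 𝔤) : ℝ :=
  bivector M (grad f M) (grad g M)

/-- The corank of the Lie–Poisson bracket: the dimension of the kernel of the bivector at a point
of maximal rank. -/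
def corank (𝔤 : LieSubalgebra ℝ (Matrix (Fin n) (Fin n) ℝ)) : ℕ :=
  ⨅ M : 𝔤, Module.finrank ℝ (LinearMap.ker (bivector M))

/-- The space `F_M` spanned by the differentials at `M` of the functions in `F`. -/
def gradSpan [SkewSubalgebra 𝔤] (F : Set (𝔤 → ℝ)) (M : 𝔤) : Submodule ℝ 𝔤 :=
  Submodule.span ℝ {ξ | ∃ f ∈ F, ξ = grad f M}

/-- The kernel of the restriction of the bivector `Λ_M` to a subspace `V`. -/
def kerOn (M : 𝔤) (V : Submodule ℝ 𝔤) : Submodule ℝ V :=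
  LinearMap.ker ((bivector M).restrict V)

/-- `F` has differential dimension `l` and differential index `d`: there are `l` functions in `F`
such that, on an open dense set of points `M`, their differentials are linearly independent and
span `F_M`, and the kernel of `Λ_M` restricted to `F_M` has dimension `d`. -/
def HasDDimDInd [SkewSubalgebra 𝔤] (F : Set (𝔤 → ℝ)) (l d : ℕ) : Prop :=
  ∃ f : Fin l → 𝔤 → ℝ, (∀ i, f i ∈ F) ∧ ∃ U : Set 𝔤, IsOpen U ∧ Dense U ∧ ∀ M ∈ U,
    LinearIndependent ℝ (fun i => grad (f i) M) ∧
    Submodule.span ℝ (Set.range fun i => grad (f i) M) = gradSpan F M ∧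
    Module.finrank ℝ (kerOn M (gradSpan F M)) = d

/-- `F` is a complete (noncommutative) set of functions: a set of smooth functions, closed under
the Poisson bracket, with `ddim F + dind F = dim + corank`. -/
structure IsCompleteSet [SkewSubalgebra 𝔤] (F : Set (𝔤 → ℝ)) : Prop where
  smooth : ∀ f ∈ F, ContDiff ℝ (⊤ : ℕ∞) f
  closed : ∀ f ∈ F, ∀ g ∈ F, poisson f g ∈ F
  complete : ∃ l d : ℕ, HasDDimDInd F l d ∧ l + d = Module.finrank ℝ 𝔤 + corank 𝔤

/-- `F` is a complete commuting set of functions: a set of pairwise Poisson-commuting smooth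
functions which contains `l = ½ (dim + corank)` functions whose differentials are independent on
an open dense set. -/
structure IsCompleteCommutingSet [SkewSubalgebra 𝔤] (F : Set (𝔤 → ℝ)) : Prop where
  smooth : ∀ f ∈ F, ContDiff ℝ (⊤ : ℕ∞) f
  comm : ∀ f ∈ F, ∀ g ∈ F, ∀ M, poisson f g M = 0
  complete : ∃ (l : ℕ) (f : Fin l → 𝔤 → ℝ), 2 * l = Module.finrank ℝ 𝔤 + corank 𝔤 ∧
    (∀ i, f i ∈ F) ∧ ∃ U : Set 𝔤, IsOpen U ∧ Dense U ∧
      ∀ M ∈ U, LinearIndependent ℝ (fun i => grad (f i) M)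

/-- The system `Ṁ = X(M)` is Hamiltonian with Hamiltonian function `H`, that is, it is
`ḟ = {f, H}` for all smooth functions `f`. -/
def IsHamiltonianSystem [SkewSubalgebra 𝔤] (X : 𝔤 → 𝔤) (H : 𝔤 → ℝ) : Prop :=
  ContDiff ℝ (⊤ : ℕ∞) H ∧
    ∀ f : 𝔤 → ℝ, ContDiff ℝ (⊤ : ℕ∞) f → ∀ M, fderiv ℝ f M (X M) = poisson f H M

/-- The system `Ṁ = X(M)` is Hamiltonian and completely integrable in the noncommutative sense,
with `F` as a complete set of first integrals. -/
def NoncommutativelyIntegrableBy [SkewSubalgebra 𝔤] (X : 𝔤 → 𝔤) (F : Set (𝔤 → ℝ)) : Prop :=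
  ∃ H : 𝔤 → ℝ, IsHamiltonianSystem X H ∧ (∀ f ∈ F, ∀ M, poisson f H M = 0) ∧ IsCompleteSet F

/-- The system `Ṁ = X(M)` is Hamiltonian and completely integrable (Liouville integrable), with
`F` as a complete commuting set of first integrals. -/
def LiouvilleIntegrableBy [SkewSubalgebra 𝔤] (X : 𝔤 → 𝔤) (F : Set (𝔤 → ℝ)) : Prop :=
  ∃ H : 𝔤 → ℝ, IsHamiltonianSystem X H ∧ (∀ f ∈ F, ∀ M, poisson f H M = 0) ∧
    IsCompleteCommutingSet F

/-- `T` is a positive definite (in particular symmetric) operator. -/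
def IsPosDefOp (T : 𝔤 →ₗ[ℝ] 𝔤) : Prop :=
  (∀ X Y, form 𝔤 (T X) Y = form 𝔤 X (T Y)) ∧ ∀ X, X ≠ 0 → 0 < form 𝔤 X (T X)

/-- The Euler equations `Ṁ = [M, Ω]`, `Ω = T(M)`. -/
def euler (T : 𝔤 →ₗ[ℝ] 𝔤) (M : 𝔤) : 𝔤 := ⁅M, T M⁆

end LiePoisson

/-! ### Symmetric rigid bodies and singular Manakov flows -/

section Flows

variable {n : ℕ}

/-- The diagonal entries `(α₁, …, α₁, …, α_r, …, α_r)`, where `α_i` occurs `k_i` times. -/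
def blockEntries {r : ℕ} (k : Fin r → ℕ) (α : Fin r → ℝ) : Fin (∑ i, k i) → ℝ :=
  fun j => α (finSigmaFinEquiv.symm j).1

/-- The isotropy algebra `so(n)_A = {X ∈ so(n) | [X, A] = 0}` of `A = diag (a₁, …, a_n)`. -/
def soA (a : Fin n → ℝ) : LieSubalgebra ℝ (Matrix (Fin n) (Fin n) ℝ) where
  carrier := {X | X ∈ so (Fin n) ℝ ∧ ⁅X, diagonal a⁆ = 0}
  add_mem' := fun hX hY => ⟨add_mem hX.1 hY.1, by rw [add_lie, hX.2, hY.2, add_zero]⟩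
  zero_mem' := ⟨zero_mem _, zero_lie _⟩
  smul_mem' := fun c X hX => ⟨(so (Fin n) ℝ).smul_mem c hX.1, by rw [smul_lie, hX.2, smul_zero]⟩
  lie_mem' := fun hX hY => ⟨(so (Fin n) ℝ).lie_mem hX.1 hY.1, by
    rw [lie_lie, hX.2, hY.2, lie_zero, lie_zero, sub_zero]⟩

instance instSkewSoA (a : Fin n → ℝ) : SkewSubalgebra (soA a) := ⟨fun _ hX => hX.1⟩

theorem skew_apply (M : so (Fin n) ℝ) (i j : Fin n) : M.1 j i = -M.1 i j :=
  congrFun (congrFun ((mem_so (Fin n) ℝ M.1).1 M.2) i) j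

/-- Multiplication of the entries of a skew-symmetric matrix by symmetric weights. -/
def weightOp (w : Fin n → Fin n → ℝ) (hw : ∀ i j, w i j = w j i) :
    so (Fin n) ℝ →ₗ[ℝ] so (Fin n) ℝ where
  toFun M := ⟨of fun i j => w i j * M.1 i j, (mem_so (Fin n) ℝ _).2 (by
    ext i j
    simp [skew_apply M i j, hw i j])⟩
  map_add' M N := by ext i j; simp [mul_add]
  map_smul' c M := by ext i j; simp; ring

/-- The projection `M ↦ M_{so(n)_A}` of `so(n) = so(n)_A ⊕ 𝔳`, where `𝔳` is the orthogonal
complement of `so(n)_A`: it keeps the entries `M_ij` with `a_i = a_j`. -/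
def projA (a : Fin n → ℝ) : so (Fin n) ℝ →ₗ[ℝ] soA a where
  toFun M := ⟨of fun i j => if a i = a j then M.1 i j else 0, (mem_so (Fin n) ℝ _).2 (by
    ext i j
    by_cases h : a i = a j
    · simp [skew_apply M i j, h]
    · simp [h, Ne.symm h]), by
    ext i j
    rw [Ring.lie_def, Matrix.sub_apply, mul_diagonal, diagonal_mul]
    by_cases h : a i = a j <;> simp [h, mul_comm]⟩
  map_add' M N := by ext i j; by_cases h : a i = a j <;> simp [h]
  map_smul' c M := by ext i j; by_cases h : a i = a j <;> simp [h]

/-- `so(n)_A` as a subspace of `so(n)`. -/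
def inclA (a : Fin n → ℝ) : soA a →ₗ[ℝ] so (Fin n) ℝ where
  toFun X := ⟨X.1, X.2.1⟩
  map_add' _ _ := rfl
  map_smul' _ _ := rfl

/-- `projA` is the orthogonal projection: it is the identity on `so(n)_A`, and `M - M_{so(n)_A}`
is orthogonal to `so(n)_A`. -/
theorem projA_orthogonal (a : Fin n → ℝ) :
    (∀ X : soA a, projA a (inclA a X) = X) ∧
    ∀ (M : so (Fin n) ℝ) (X : soA a),
      form (so (Fin n) ℝ) (M - inclA a (projA a M)) (inclA a X) = 0 := by
  have hX0 : ∀ (X : soA a) (i j), a i ≠ a j → X.1 i j = 0 := by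
    intro X i j h
    have h1 := congrFun (congrFun X.2.2 i) j
    rw [Ring.lie_def, Matrix.sub_apply, mul_diagonal, diagonal_mul] at h1
    have h2 : (a j - a i) * X.1 i j = 0 := by
      rw [sub_mul, mul_comm (a j)]; exact h1
    exact (mul_eq_zero.1 h2).resolve_left (sub_ne_zero.2 (Ne.symm h))
  refine ⟨fun X => ?_, fun M X => ?_⟩
  · ext i j
    by_cases h : a i = a j
    · simp [projA, inclA, h]
    · simp [projA, inclA, h, hX0 X i j h]
  · rw [form_apply, trace, Finset.sum_eq_zero, mul_zero]
    intro i _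
    rw [diag_apply, mul_apply]
    refine Finset.sum_eq_zero fun j _ => ?_
    by_cases h : a i = a j
    · simp [projA, inclA, h]
    · have : (inclA a X).1 j i = 0 := hX0 X j i (Ne.symm h)
      rw [this, mul_zero]

/-- The operator `ad_A⁻¹ ad_B` on `𝔳`, extended by `0` to `so(n)_A`: the entry `M_ij` is
multiplied by `(b_i - b_j) / (a_i - a_j)` if `a_i ≠ a_j`, and by `0` otherwise. -/
def adInvAd (a b : Fin n → ℝ) : so (Fin n) ℝ →ₗ[ℝ] so (Fin n) ℝ :=
  weightOp (fun i j => if a i = a j then 0 else (b i - b j) / (a i - a j)) (fun i j => by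
    rw [← neg_sub (b j) (b i), ← neg_sub (a j) (a i), neg_div_neg_eq]
    simp [eq_comm])

/-- The value `Ω = ad_A⁻¹ ad_B (M_𝔳)` satisfies `[A, Ω] = [B, M_𝔳]` and is orthogonal to
`so(n)_A`. -/
theorem adInvAd_spec (a b : Fin n → ℝ) (M : so (Fin n) ℝ) :
    ⁅diagonal a, (adInvAd a b M).1⁆ = ⁅diagonal b, (M - inclA a (projA a M)).1⁆ ∧
      projA a (adInvAd a b M) = 0 := by
  constructor
  · ext i j
    rw [Ring.lie_def, Ring.lie_def, Matrix.sub_apply, Matrix.sub_apply, mul_diagonal,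
      diagonal_mul, mul_diagonal, diagonal_mul]
    by_cases h : a i = a j
    · simp [adInvAd, weightOp, projA, inclA, h]
    · have h' : a i - a j ≠ 0 := sub_ne_zero.2 h
      simp [adInvAd, weightOp, projA, inclA, h]
      field_simp
  · ext i j
    by_cases h : a i = a j <;> simp [adInvAd, weightOp, projA, h]

/-- The operator `𝔄 (M_𝔳 + M_{so(n)_A}) = ad_A⁻¹ ad_B (M_𝔳) + 𝔅 (M_{so(n)_A})` of the singular
Manakov flow. -/
def manakovOp (a b : Fin n → ℝ) (𝔅 : soA a →ₗ[ℝ] soA a) : so (Fin n) ℝ →ₗ[ℝ] so (Fin n) ℝ :=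
  adInvAd a b + inclA a ∘ₗ 𝔅 ∘ₗ projA a

/-- The operator `Ω_ij = M_ij / (b_i + b_j)` of a rigid body with mass tensor
`B = diag (b₁, …, b_n)`. -/
def rigidBodyOp (b : Fin n → ℝ) : so (Fin n) ℝ →ₗ[ℝ] so (Fin n) ℝ :=
  weightOp (fun i j => 1 / (b i + b j)) (fun i j => by rw [add_comm])

/-- The Manakov integrals `𝓛 = {tr (M + λ A)^k | k = 1, …, n, λ ∈ ℝ}`. -/
def manakovIntegrals (a : Fin n → ℝ) : Set (so (Fin n) ℝ → ℝ) :=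
  {f | ∃ k ∈ Finset.Icc 1 n, ∃ t : ℝ, f = fun M => trace ((M.1 + t • diagonal a) ^ k)}

/-- Functions on `so(n)_A`, considered as functions of `M ∈ so(n)` through `M_{so(n)_A}`. -/
def pullbackA (a : Fin n → ℝ) (S : Set (soA a → ℝ)) : Set (so (Fin n) ℝ → ℝ) :=
  {f | ∃ s ∈ S, f = fun M => s (projA a M)}

/-- The set `𝓢` of linear functions on `so(n)_A`. -/
def linearFunctions (a : Fin n → ℝ) : Set (soA a → ℝ) :=
  {s | ∃ φ : soA a →ₗ[ℝ] ℝ, s = φ}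

end Flows

end

end Manakov

open Manakov

/-! Write `p` for the number of odd pairs: indices `i < j` in different blocks with `j - i` odd. The
gradient of `tr (M + tA)^k` is a multiple of the skew part of `(M + tA)^(k-1)`. Commuting with `M +
tA`, and the sign change of `M` under transposition, show that these gradients are mutually
isotropic for `Λ_M` and orthogonal to all of `so(n)_A` (`poisson_manakovFun`,
`bivector_grad_manakovFun_inclA`).

Completeness is a dimension count. Let `L` be the span of the Manakov gradients, `F = L + so(n)_A`,
and `R = L + ker Λ` with `Λ` taken on `so(n)_A` at the projection of `M`. Then `R` lies in `F` and
in its `Λ_M`-orthogonal, so at generic `M` one has `dim F + dim R ≤ dim so(n) + corank so(n)`. If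
`L` has rank at least `p` modulo `so(n)_A`, the left side is at least `2p + dim so(n)_A + corank
so(n)_A`, and `finrank_add_corank_le` bounds the right side above by the same number. Hence all
these estimates are equalities (`finrank_span_and_kerOn`), which gives (i). For (ii), `p` Manakov
integrals are joined to the pulled-back commuting ones.

By analyticity, independence need only be found at one point, and the tridiagonal `pathSkew` is
explicit enough. Powers of the pencil control its resolvents, whose expansion at `pathSkew` has band
entries `∏ (a_e - u)⁻¹`; varying `u` separates the odd pairs (`band_eq_zero`,
`coefficients_eq_zero`). The same matrix bounds `corank so(n)` from above, and its diagonal blocks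
bound `corank so(n)_A` from below.

Conservation of the Manakov integrals is the Lax form of the equations (`fderiv_manakovFun_lie`).
The projection to `so(n)_A` is constant for the rigid body and follows the given reduced system for
the Manakov flow. -/

namespace Manakov

open Module
open scoped ContDiff

/-! ### Generic points -/

section Generic

variable {E W : Type*} [NormedAddCommGroup E] [NormedSpace ℝ E]
  [NormedAddCommGroup W] [NormedSpace ℝ W]

theorem contDiff_of_linear [FiniteDimensional ℝ E] {m : WithTop ℕ∞} (f : E →ₗ[ℝ] W) :
    ContDiff ℝ m f :=
  f.toContinuousLinearMap.contDiff

/-- A real analytic function which is not identically zero is nonzero on an open dense set. -/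
theorem isOpen_dense_ne_zero {f : E → ℝ} (hf : ContDiff ℝ ω f) {x₀ : E} (h₀ : f x₀ ≠ 0) :
    IsOpen {x | f x ≠ 0} ∧ Dense {x | f x ≠ 0} := by
  refine ⟨isOpen_ne_fun hf.continuous continuous_const, ?_⟩
  rw [← compl_compl {x | f x ≠ 0}, ← interior_eq_empty_iff_dense_compl]
  by_contra hne
  obtain ⟨x, hx⟩ := Set.nonempty_iff_ne_empty.2 hne
  have ha : AnalyticOnNhd ℝ f Set.univ := contDiff_omega_iff_analyticOnNhd.1 hf
  have := ha.eqOn_zero_of_preconnected_of_eventuallyEq_zero isPreconnected_univ (Set.mem_univ x)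
    (by
      filter_upwards [mem_interior_iff_mem_nhds.1 hx] with y hy
      simpa using hy)
  exact h₀ (this (Set.mem_univ x₀))

/-- A real analytic family of vectors which is linearly independent at one point is so on an open
dense set. -/
theorem exists_dense_linearIndependent [FiniteDimensional ℝ W] {ι : Type*} [Finite ι]
    {v : ι → E → W} (hv : ∀ i, ContDiff ℝ ω (v i)) {x₀ : E}
    (h₀ : LinearIndependent ℝ fun i => v i x₀) :
    ∃ U : Set E, IsOpen U ∧ Dense U ∧ ∀ x ∈ U, LinearIndependent ℝ fun i => v i x := by
  classical
  have := Fintype.ofFinite ι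
  -- Composing with a left inverse at `x₀` gives a square matrix that is the identity at `x₀`, so
  -- its determinant is an analytic function to which the previous lemma applies.
  obtain ⟨g, hg⟩ := LinearMap.exists_leftInverse_of_injective
    (Fintype.linearCombination ℝ fun i => v i x₀)
    (LinearMap.ker_eq_bot'.2 fun c hc => funext (Fintype.linearIndependent_iff.1 h₀ c hc))
  have hgv : ∀ i, g (v i x₀) = Pi.single i 1 := by
    intro i
    have := LinearMap.congr_fun hg (Pi.single i 1)
    simpa [Fintype.linearCombination_apply_single] using this
  have hfd : ContDiff ℝ ω fun x => det (of fun i j => g (v i x) j) := by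
    simp only [det_apply, of_apply]
    refine ContDiff.sum fun σ _ => ContDiff.const_smul _ (contDiff_prod fun i _ => ?_)
    exact (contDiff_apply ℝ ℝ i).comp ((contDiff_of_linear g).comp (hv _))
  have h1 : det (of fun i j => g (v i x₀) j) ≠ 0 := by
    have : (of fun i j => g (v i x₀) j) = (1 : Matrix ι ι ℝ) := by
      ext i j
      simp [hgv, Matrix.one_apply, Pi.single_apply, eq_comm]
    rw [this, det_one]
    exact one_ne_zero
  obtain ⟨hU, hU'⟩ := isOpen_dense_ne_zero hfd h1
  refine ⟨_, hU, hU', fun x hx => LinearIndependent.of_comp g ?_⟩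
  exact linearIndependent_rows_of_det_ne_zero hx

end Generic

/-- Fixed vectors that witness the rank of one map keep bounding the rank from below when the map is
varied. -/
theorem exists_fun_linearIndependent_map {V W : Type*} [AddCommGroup V] [Module ℝ V]
    [AddCommGroup W] [Module ℝ W] [FiniteDimensional ℝ W] (T : V →ₗ[ℝ] W) :
    ∃ f : Fin (finrank ℝ (LinearMap.range T)) → V, LinearIndependent ℝ fun i => T (f i) := by
  let b := finBasis ℝ (LinearMap.range T)
  choose f hf using fun i => LinearMap.mem_range.1 (b i).2
  refine ⟨f, ?_⟩
  have := b.linearIndependent.map' (LinearMap.range T).subtype (Submodule.ker_subtype _)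
  have h2 : (LinearMap.range T).subtype ∘ b = fun i => T (f i) := funext fun i => (hf i).symm
  rwa [h2] at this

/-! ### Kernel of the bivector and corank at generic points. -/

section Corank

variable {n : ℕ} {𝔤 : LieSubalgebra ℝ (Matrix (Fin n) (Fin n) ℝ)}

theorem form_lie (X Y Z : 𝔤) : form 𝔤 ⁅X, Y⁆ Z = form 𝔤 X ⁅Y, Z⁆ := by
  simp only [form_apply, LieSubalgebra.coe_bracket, Ring.lie_def, sub_mul, mul_sub, trace_sub]
  rw [mul_assoc, mul_assoc, trace_mul_comm Y.1, mul_assoc]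

theorem bivector_apply (M ξ η : 𝔤) : bivector M ξ η = -form 𝔤 M ⁅ξ, η⁆ := rfl

theorem bivector_eq (M ξ η : 𝔤) : bivector M ξ η = -form 𝔤 ⁅M, ξ⁆ η := by
  rw [bivector_apply, form_lie]

theorem bivector_swap (M ξ η : 𝔤) : bivector M ξ η = -bivector M η ξ := by
  rw [bivector_apply, bivector_apply, ← lie_skew, map_neg]

theorem mem_ker_bivector [SkewSubalgebra 𝔤] {M ξ : 𝔤} :
    ξ ∈ LinearMap.ker (bivector M) ↔ ⁅M, ξ⁆ = 0 := by
  rw [LinearMap.mem_ker]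
  constructor
  · intro h
    refine form_nondegenerate.1 _ fun η => ?_
    have := LinearMap.congr_fun h η
    rw [bivector_eq] at this
    simpa using this
  · intro h
    ext η
    rw [bivector_eq, h]
    simp

theorem ker_bivector [SkewSubalgebra 𝔤] (M : 𝔤) :
    LinearMap.ker (bivector M) = LinearMap.ker (LieAlgebra.ad ℝ 𝔤 M) := by
  ext ξ
  rw [mem_ker_bivector, LinearMap.mem_ker, LieAlgebra.ad_apply]

theorem corank_le (M : 𝔤) : corank 𝔤 ≤ finrank ℝ (LinearMap.ker (bivector M)) :=
  Nat.sInf_le ⟨M, rfl⟩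

/-- The corank is the dimension of the kernel of the bivector at generic points. -/
theorem exists_dense_finrank_ker_eq [SkewSubalgebra 𝔤] :
    ∃ U : Set 𝔤, IsOpen U ∧ Dense U ∧
      ∀ M ∈ U, finrank ℝ (LinearMap.ker (bivector M)) = corank 𝔤 := by
  obtain ⟨M₁, hM₁⟩ : corank 𝔤 ∈ Set.range fun M : 𝔤 => finrank ℝ (LinearMap.ker (bivector M)) :=
    Nat.sInf_mem (Set.range_nonempty _)
  -- The kernel at `M` is that of `ad M`, so minimal kernel at `M₁` means maximal rank of `ad`, and
  -- the rank cannot drop generically.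
  obtain ⟨f, hf⟩ := exists_fun_linearIndependent_map (LieAlgebra.ad ℝ 𝔤 M₁)
  obtain ⟨U, hU, hU', h⟩ := exists_dense_linearIndependent
    (v := fun i (M : 𝔤) => LieAlgebra.ad ℝ 𝔤 M (f i)) (fun i =>
      contDiff_of_linear ((LinearMap.applyₗ (f i)).comp (LieAlgebra.ad ℝ 𝔤).toLinearMap)) hf
  refine ⟨U, hU, hU', fun M hM => le_antisymm ?_ (corank_le M)⟩
  have h1 := (LieAlgebra.ad ℝ 𝔤 M).finrank_range_add_finrank_ker
  have h2 := (LieAlgebra.ad ℝ 𝔤 M₁).finrank_range_add_finrank_ker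
  have h3 : finrank ℝ (LinearMap.range (LieAlgebra.ad ℝ 𝔤 M₁)) ≤
      finrank ℝ (LinearMap.range (LieAlgebra.ad ℝ 𝔤 M)) := by
    have h4 : LinearIndependent ℝ fun i => (LieAlgebra.ad ℝ 𝔤 M).rangeRestrict (f i) :=
      LinearIndependent.of_comp (LinearMap.range (LieAlgebra.ad ℝ 𝔤 M)).subtype (h M hM)
    simpa using h4.fintype_card_le_finrank
  have h5 : ∀ M : 𝔤, finrank ℝ (LinearMap.ker (bivector M)) =
      finrank ℝ (LinearMap.ker (LieAlgebra.ad ℝ 𝔤 M)) := fun M => by rw [ker_bivector]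
  have := h5 M
  have := h5 M₁
  dsimp only at hM₁
  omega

end Corank

/-! ### Gradients and brackets -/

section Derivatives

variable {E F : Type*} [NormedAddCommGroup E] [NormedSpace ℝ E]
  [NormedAddCommGroup F] [NormedSpace ℝ F]

theorem fderiv_eq_of_hasDerivAt {f : E → ℝ} {M Y : E} (hf : ContDiff ℝ (⊤ : ℕ∞) f) {c : ℝ}
    (h : HasDerivAt (fun s : ℝ => f (M + s • Y)) c 0) : fderiv ℝ f M Y = c := by
  have hd : DifferentiableAt ℝ f M := (hf.differentiable (by simp)).differentiableAt
  rw [← hd.lineDeriv_eq_fderiv]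
  exact HasLineDerivAt.lineDeriv h

theorem fderiv_comp_linear [FiniteDimensional ℝ E] {f : F → ℝ} (hf : ContDiff ℝ (⊤ : ℕ∞) f)
    (T : E →ₗ[ℝ] F) (M Y : E) :
    fderiv ℝ (fun M => f (T M)) M Y = fderiv ℝ f (T M) (T Y) := by
  have h1 : HasFDerivAt f (fderiv ℝ f (T M)) (T.toContinuousLinearMap M) :=
    (hf.differentiable (by simp)).differentiableAt.hasFDerivAt
  have h2 := h1.comp M T.toContinuousLinearMap.hasFDerivAt
  exact congrArg (fun L => L Y) h2.fderiv

end Derivatives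

section Gradients

variable {n : ℕ} {𝔤 : LieSubalgebra ℝ (Matrix (Fin n) (Fin n) ℝ)}

theorem form_left_injective [SkewSubalgebra 𝔤] {X Y : 𝔤}
    (h : ∀ Z, form 𝔤 X Z = form 𝔤 Y Z) : X = Y := by
  rw [← sub_eq_zero]
  refine form_nondegenerate.1 _ fun Z => ?_
  rw [map_sub, LinearMap.sub_apply, h Z, sub_self]

theorem grad_eq [SkewSubalgebra 𝔤] {f : 𝔤 → ℝ} {M G : 𝔤}
    (h : ∀ Y, fderiv ℝ f M Y = form 𝔤 G Y) : grad f M = G :=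
  form_left_injective fun Z => by rw [form_grad, h]

theorem poisson_swap [SkewSubalgebra 𝔤] (f g : 𝔤 → ℝ) (M : 𝔤) :
    poisson f g M = -poisson g f M :=
  bivector_swap _ _ _

/-- The Hamiltonian `½ ⟨M, T M⟩`. -/
noncomputable def energy (T : 𝔤 →ₗ[ℝ] 𝔤) (M : 𝔤) : ℝ := (1 / 2 : ℝ) * form 𝔤 M (T M)

theorem contDiff_coe_apply {m : WithTop ℕ∞} (i j : Fin n) :
    ContDiff ℝ m fun M : 𝔤 => M.1 i j :=
  contDiff_of_linear (((LinearMap.proj j).comp (LinearMap.proj i)).comp 𝔤.toSubmodule.subtype)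

theorem contDiff_form {E : Type*} [NormedAddCommGroup E] [NormedSpace ℝ E] {m : WithTop ℕ∞}
    {f g : E → 𝔤} (hf : ContDiff ℝ m f) (hg : ContDiff ℝ m g) :
    ContDiff ℝ m fun x => form 𝔤 (f x) (g x) := by
  simp only [form_apply, trace, diag_apply, mul_apply]
  exact contDiff_const.mul (ContDiff.sum fun i _ => ContDiff.sum fun j _ =>
    ((contDiff_coe_apply i j).comp hf).mul ((contDiff_coe_apply j i).comp hg))

theorem contDiff_energy (T : 𝔤 →ₗ[ℝ] 𝔤) : ContDiff ℝ (⊤ : ℕ∞) (energy T) :=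
  contDiff_const.mul (contDiff_form contDiff_id (contDiff_of_linear T))

theorem grad_energy [SkewSubalgebra 𝔤] {T : 𝔤 →ₗ[ℝ] 𝔤}
    (hT : ∀ X Y, form 𝔤 (T X) Y = form 𝔤 X (T Y)) (M : 𝔤) : grad (energy T) M = T M := by
  refine grad_eq fun Y => fderiv_eq_of_hasDerivAt (contDiff_energy T) ?_
  have h : (fun s : ℝ => energy T (M + s • Y)) = fun s : ℝ =>
      energy T M + s * form 𝔤 (T M) Y + s * s * energy T Y := by
    funext s
    have := hT M Y
    have := form_symm Y (T M)
    simp only [energy, map_add, map_smul, LinearMap.add_apply, LinearMap.smul_apply, smul_eq_mul]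
    linear_combination (1 / 2 * s) * form_symm Y (T M) - (1 / 2 * s) * hT M Y
  rw [h]
  have h1 := ((hasDerivAt_id (0 : ℝ)).mul_const (form 𝔤 (T M) Y)).const_add (energy T M)
  have h2 := ((hasDerivAt_id (0 : ℝ)).mul (hasDerivAt_id (0 : ℝ))).mul_const (energy T Y)
  refine (h1.add h2).congr_deriv ?_
  simp

/-- Invariance of the form moves the bracket onto `M` and `T M`. Conservation laws thereby become
vanishing derivatives along the Euler field. -/
theorem poisson_energy [SkewSubalgebra 𝔤] {T : 𝔤 →ₗ[ℝ] 𝔤}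
    (hT : ∀ X Y, form 𝔤 (T X) Y = form 𝔤 X (T Y)) (f : 𝔤 → ℝ) (M : 𝔤) :
    poisson f (energy T) M = fderiv ℝ f M (euler T M) := by
  rw [poisson_swap, poisson, bivector_eq, neg_neg, grad_energy hT, form_symm, form_grad]
  rfl

theorem isHamiltonianSystem_euler [SkewSubalgebra 𝔤] {T : 𝔤 →ₗ[ℝ] 𝔤}
    (hT : ∀ X Y, form 𝔤 (T X) Y = form 𝔤 X (T Y)) :
    IsHamiltonianSystem (euler T) (energy T) :=
  ⟨contDiff_energy T, fun f _ M => (poisson_energy hT f M).symm⟩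

end Gradients

/-! ### Powers of matrices -/

section Powers

variable {n : ℕ}

/-- Twice the skew-symmetric part of a matrix. -/
def skewPart : Matrix (Fin n) (Fin n) ℝ →ₗ[ℝ] so (Fin n) ℝ where
  toFun X := ⟨X - Xᵀ, (mem_so (Fin n) ℝ _).2 (by simp)⟩
  map_add' X Y := by ext i j; simp; ring
  map_smul' c X := by ext i j; simp; ring

theorem coe_skewPart (X : Matrix (Fin n) (Fin n) ℝ) : (skewPart X).1 = X - Xᵀ := rfl

theorem transpose_coe_so (M : so (Fin n) ℝ) : M.1ᵀ = -M.1 :=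
  (mem_so (Fin n) ℝ M.1).1 M.2

/-- Only the skew part of `X` is seen by a skew `Y`, and the factor two in `skewPart` cancels the
one half of the form. -/
theorem form_skewPart (X : Matrix (Fin n) (Fin n) ℝ) (Y : so (Fin n) ℝ) :
    form (so (Fin n) ℝ) (skewPart X) Y = -trace (X * Y.1) := by
  have h : trace (Xᵀ * Y.1) = -trace (X * Y.1) := by
    rw [← trace_transpose, transpose_mul, transpose_transpose, transpose_coe_so, neg_mul,
      trace_neg, trace_mul_comm]
  rw [form_apply, coe_skewPart, sub_mul, trace_sub, h]
  ring

/-- The derivative of the `k`-th power at `X` in the direction `Y`. -/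
def powDeriv (X Y : Matrix (Fin n) (Fin n) ℝ) : ℕ → Matrix (Fin n) (Fin n) ℝ
  | 0 => 0
  | k + 1 => powDeriv X Y k * X + X ^ k * Y

theorem hasDerivAt_pow_apply (X Y : Matrix (Fin n) (Fin n) ℝ) (k : ℕ) (i j : Fin n) :
    HasDerivAt (fun s : ℝ => ((X + s • Y) ^ k) i j) (powDeriv X Y k i j) 0 := by
  induction k generalizing i j with
  | zero => simpa [powDeriv] using hasDerivAt_const _ _
  | succ k ih =>
    simp only [pow_succ, mul_apply, powDeriv, Matrix.add_apply, ← Finset.sum_add_distrib]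
    refine HasDerivAt.fun_sum fun l _ => ?_
    have h1 : HasDerivAt (fun s : ℝ => X l j + (s • Y) l j) (Y l j) 0 := by
      simpa using ((hasDerivAt_id (0 : ℝ)).mul_const (Y l j)).const_add (X l j)
    refine ((ih i l).mul h1).congr_deriv ?_
    simp

/-- Cyclicity of the trace; the extra factor `X ^ m` lets the induction close. The truncated `k - 1`
is harmless at `k = 0`, where the coefficient is zero. -/
theorem trace_powDeriv_mul_pow (X Y : Matrix (Fin n) (Fin n) ℝ) (k m : ℕ) :
    trace (powDeriv X Y k * X ^ m) = k * trace (X ^ (k - 1 + m) * Y) := by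
  induction k generalizing m with
  | zero => simp [powDeriv]
  | succ k ih =>
    rw [powDeriv, add_mul, trace_add, mul_assoc, ← pow_succ', ih, mul_assoc, trace_mul_comm (X ^ k),
      mul_assoc, ← pow_add, trace_mul_comm Y, Nat.add_sub_cancel, add_comm m k]
    rcases k with _ | k
    · simp
    · rw [show k + 1 - 1 + (m + 1) = k + 1 + m by omega]
      push_cast
      ring

theorem contDiff_pow_apply {E : Type*} [NormedAddCommGroup E] [NormedSpace ℝ E]
    {m : WithTop ℕ∞} {F : E → Matrix (Fin n) (Fin n) ℝ}
    (hF : ∀ i j, ContDiff ℝ m fun x => F x i j) (k : ℕ) (i j : Fin n) :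
    ContDiff ℝ m fun x => (F x ^ k) i j := by
  induction k generalizing i j with
  | zero => simpa using contDiff_const
  | succ k ih =>
    simp only [pow_succ, mul_apply]
    exact ContDiff.sum fun l _ => (ih i l).mul (hF l j)

/-- The Manakov integral `tr (M + t A) ^ k`. -/
def manakovFun (a : Fin n → ℝ) (k : ℕ) (t : ℝ) (M : so (Fin n) ℝ) : ℝ :=
  trace ((M.1 + t • diagonal a) ^ k)

theorem contDiff_shift_pow_apply {m : WithTop ℕ∞} (a : Fin n → ℝ) (k : ℕ) (t : ℝ) (i j : Fin n) :
    ContDiff ℝ m fun M : so (Fin n) ℝ => ((M.1 + t • diagonal a) ^ k) i j :=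
  contDiff_pow_apply (fun i j => (contDiff_coe_apply i j).add contDiff_const) k i j

theorem contDiff_manakovFun {m : WithTop ℕ∞} (a : Fin n → ℝ) (k : ℕ) (t : ℝ) :
    ContDiff ℝ m (manakovFun a k t) := by
  unfold manakovFun trace
  exact ContDiff.sum fun i _ => contDiff_shift_pow_apply a k t i i

theorem fderiv_manakovFun (a : Fin n → ℝ) (k : ℕ) (t : ℝ) (M Y : so (Fin n) ℝ) :
    fderiv ℝ (manakovFun a k t) M Y =
      k * trace ((M.1 + t • diagonal a) ^ (k - 1) * Y.1) := by
  refine fderiv_eq_of_hasDerivAt (contDiff_manakovFun a k t) ?_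
  have h := trace_powDeriv_mul_pow (M.1 + t • diagonal a) Y.1 k 0
  rw [pow_zero, mul_one, add_zero] at h
  rw [← h]
  have h1 : (fun s : ℝ => manakovFun a k t (M + s • Y)) = fun s : ℝ =>
      ∑ i, ((M.1 + t • diagonal a + s • Y.1) ^ k) i i := by
    funext s
    rw [manakovFun, trace, show (M + s • Y).1 = M.1 + s • Y.1 from rfl, add_right_comm]
    rfl
  rw [h1]
  exact HasDerivAt.fun_sum fun i _ => hasDerivAt_pow_apply _ _ _ _ _

theorem grad_manakovFun (a : Fin n → ℝ) (k : ℕ) (t : ℝ) (M : so (Fin n) ℝ) :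
    grad (manakovFun a k t) M = (-k : ℝ) • skewPart ((M.1 + t • diagonal a) ^ (k - 1)) := by
  refine grad_eq fun Y => ?_
  rw [fderiv_manakovFun, map_smul, LinearMap.smul_apply, form_skewPart, smul_eq_mul]
  ring

theorem contDiff_grad_manakovFun {m : WithTop ℕ∞} (a : Fin n → ℝ) (k : ℕ) (t : ℝ) :
    ContDiff ℝ m (grad (manakovFun a k t)) := by
  -- In matrix units the coefficients are polynomials in the entries of `M`, hence analytic, as the
  -- genericity argument requires.
  have h : grad (manakovFun a k t) = fun M : so (Fin n) ℝ => (-k : ℝ) •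
      ∑ i, ∑ j, ((M.1 + t • diagonal a) ^ (k - 1)) i j • skewPart (Matrix.single i j (1 : ℝ)) := by
    funext M
    rw [grad_manakovFun]
    congr 1
    conv_lhs => rw [matrix_eq_sum_single ((M.1 + t • diagonal a) ^ (k - 1))]
    simp only [map_sum, ← map_smul, smul_single, smul_eq_mul, mul_one]
  rw [h]
  exact ContDiff.const_smul _ (ContDiff.sum fun i _ => ContDiff.sum fun j _ =>
    (contDiff_shift_pow_apply a (k - 1) t i j).smul contDiff_const)

end Powers

/-! ### Involution -/

section Involution

variable {n : ℕ}

theorem trace_lie_rotate (X Y Z : Matrix (Fin n) (Fin n) ℝ) :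
    trace (⁅X, Y⁆ * Z) = trace (⁅Y, Z⁆ * X) := by
  simp only [Ring.lie_def, sub_mul, trace_sub]
  rw [mul_assoc, trace_mul_comm X, mul_assoc Z Y X, trace_mul_comm Z, mul_assoc, mul_assoc]

theorem trace_lie_swap (X Y Z : Matrix (Fin n) (Fin n) ℝ) :
    trace (⁅X, Y⁆ * Z) = -trace (⁅X, Z⁆ * Y) := by
  rw [trace_lie_rotate, trace_lie_rotate, ← lie_skew, neg_mul, trace_neg]

theorem trace_neg_smul_mul (t : ℝ) (X Y : Matrix (Fin n) (Fin n) ℝ) :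
    trace (-(t • X) * Y) = -t * trace (X * Y) := by
  simp

variable {M : so (Fin n) ℝ} {a : Fin n → ℝ} {t : ℝ} {U : Matrix (Fin n) (Fin n) ℝ}

/-- Transposition turns `M + tA` into `-M + tA`, which accounts for the sign opposite to that in
`lie_of_commute`. -/
theorem lie_transpose_of_commute (h : Commute (M.1 + t • diagonal a) U) :
    ⁅M.1, Uᵀ⁆ = t • ⁅diagonal a, Uᵀ⁆ := by
  have h1 := congrArg transpose h.eq
  simp only [transpose_mul, transpose_add, transpose_smul, diagonal_transpose,
    transpose_coe_so] at h1
  simp only [mul_add, add_mul, mul_neg, neg_mul, smul_mul_assoc, mul_smul_comm] at h1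
  rw [Ring.lie_def, Ring.lie_def, smul_sub]
  linear_combination (norm := module) h1

theorem lie_of_commute (h : Commute (M.1 + t • diagonal a) U) :
    ⁅M.1, U⁆ = -(t • ⁅diagonal a, U⁆) := by
  have h1 := h.eq
  simp only [mul_add, add_mul, smul_mul_assoc, mul_smul_comm] at h1
  rw [Ring.lie_def, Ring.lie_def, smul_sub]
  linear_combination (norm := module) h1

theorem lie_sub_transpose_of_commute (h : Commute (M.1 + t • diagonal a) U) :
    ⁅M.1, U - Uᵀ⁆ = -(t • ⁅diagonal a, U + Uᵀ⁆) := by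
  rw [lie_sub, lie_add, lie_of_commute h, lie_transpose_of_commute h, smul_add, neg_add,
    sub_eq_add_neg]

theorem lie_add_transpose_of_commute (h : Commute (M.1 + t • diagonal a) U) :
    ⁅M.1, U + Uᵀ⁆ = -(t • ⁅diagonal a, U - Uᵀ⁆) := by
  rw [lie_sub, lie_add, lie_of_commute h, lie_transpose_of_commute h, smul_sub]
  abel

/-- With `x = tr([M,U₋]V₋)`, `y = tr([M,U₊]V₊)`, `P = tr([A,U₊]V₋)`, `Q = tr([A,U₋]V₊)`, where `±`
marks the sum and difference with the transpose, one has `x = -tP = -sQ` and `y = -tQ = -sP`. Hence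
`s²x = sty = t²x`. -/
theorem trace_lie_skewPart_mul_eq_zero {s : ℝ} {V : Matrix (Fin n) (Fin n) ℝ}
    (hU : Commute (M.1 + t • diagonal a) U) (hV : Commute (M.1 + s • diagonal a) V)
    (hst : t ^ 2 ≠ s ^ 2) : trace (⁅M.1, U - Uᵀ⁆ * (V - Vᵀ)) = 0 := by
  have e1 : trace (⁅M.1, U - Uᵀ⁆ * (V - Vᵀ)) =
      -t * trace (⁅diagonal a, U + Uᵀ⁆ * (V - Vᵀ)) := by
    rw [lie_sub_transpose_of_commute hU, trace_neg_smul_mul]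
  have e2 : trace (⁅M.1, U + Uᵀ⁆ * (V + Vᵀ)) =
      -t * trace (⁅diagonal a, U - Uᵀ⁆ * (V + Vᵀ)) := by
    rw [lie_add_transpose_of_commute hU, trace_neg_smul_mul]
  have e3 : trace (⁅M.1, V - Vᵀ⁆ * (U - Uᵀ)) =
      -s * trace (⁅diagonal a, V + Vᵀ⁆ * (U - Uᵀ)) := by
    rw [lie_sub_transpose_of_commute hV, trace_neg_smul_mul]
  have e4 : trace (⁅M.1, V + Vᵀ⁆ * (U + Uᵀ)) =
      -s * trace (⁅diagonal a, V - Vᵀ⁆ * (U + Uᵀ)) := by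
    rw [lie_add_transpose_of_commute hV, trace_neg_smul_mul]
  rw [trace_lie_swap M.1, trace_lie_swap (diagonal a)] at e3 e4
  have : (s ^ 2 - t ^ 2) * trace (⁅M.1, U - Uᵀ⁆ * (V - Vᵀ)) = 0 := by
    linear_combination s ^ 2 * e1 + s * t * e4 + s * t * e2 + t ^ 2 * e3
  exact (mul_eq_zero.1 this).resolve_left (sub_ne_zero.2 hst.symm)

theorem trace_lie_skewPart_pow_eq_zero (M : so (Fin n) ℝ) (a : Fin n → ℝ) (t s : ℝ) (j k : ℕ) :
    trace (⁅M.1, (M.1 + t • diagonal a) ^ j - ((M.1 + t • diagonal a) ^ j)ᵀ⁆ *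
      ((M.1 + s • diagonal a) ^ k - ((M.1 + s • diagonal a) ^ k)ᵀ)) = 0 := by
  -- The excluded values `t = ±s` are recovered by continuity in `t`.
  have hd : Dense {t : ℝ | t ^ 2 ≠ s ^ 2} := by
    have : {t : ℝ | t ^ 2 ≠ s ^ 2} = ({s, -s} : Set ℝ)ᶜ := by
      ext t
      simp [sq_eq_sq_iff_eq_or_eq_neg]
    rw [this]
    exact (Set.toFinite _).countable.dense_compl ℝ
  have hc : Continuous fun t : ℝ =>
      trace (⁅M.1, (M.1 + t • diagonal a) ^ j - ((M.1 + t • diagonal a) ^ j)ᵀ⁆ *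
      ((M.1 + s • diagonal a) ^ k - ((M.1 + s • diagonal a) ^ k)ᵀ)) := by
    simp only [Ring.lie_def]
    fun_prop
  exact congrFun (hc.ext_on hd continuous_const fun t ht =>
    trace_lie_skewPart_mul_eq_zero ((Commute.refl _).pow_right j) ((Commute.refl _).pow_right k)
      ht) t

theorem poisson_manakovFun (M : so (Fin n) ℝ) (a : Fin n → ℝ) (t s : ℝ) (j k : ℕ) :
    poisson (manakovFun a j t) (manakovFun a k s) M = 0 := by
  rw [poisson, grad_manakovFun, grad_manakovFun, map_smul, map_smul, LinearMap.smul_apply,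
    bivector_eq, form_apply, LieSubalgebra.coe_bracket, coe_skewPart, coe_skewPart,
    trace_lie_skewPart_pow_eq_zero]
  simp

/-- The commutator of `M` with the gradient is a commutator with `A`, and the trace moves that onto
`Z`, which commutes with `A`. -/
theorem bivector_grad_manakovFun_inclA (M : so (Fin n) ℝ) (a : Fin n → ℝ) (t : ℝ) (k : ℕ)
    (Z : soA a) : bivector M (grad (manakovFun a k t) M) (inclA a Z) = 0 := by
  have hZ : ⁅diagonal a, (inclA a Z).1⁆ = 0 := by
    rw [← lie_skew, show ⁅(inclA a Z).1, diagonal a⁆ = 0 from Z.2.2, neg_zero]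
  rw [grad_manakovFun, map_smul, LinearMap.smul_apply, bivector_eq, form_apply,
    LieSubalgebra.coe_bracket, coe_skewPart,
    lie_sub_transpose_of_commute ((Commute.refl _).pow_right _), trace_neg_smul_mul,
    trace_lie_swap, hZ]
  simp

end Involution

/-! ### Functions on the isotropy algebra -/

section Pullback

variable {n : ℕ} {a : Fin n → ℝ}

/-- Orthogonality makes `projA` and `inclA` adjoint; this is why gradients of pulled-back functions
lie in `so(n)_A`. -/
theorem form_inclA (M : so (Fin n) ℝ) (X : soA a) :
    form (so (Fin n) ℝ) M (inclA a X) = form (soA a) (projA a M) X := by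
  have h := (projA_orthogonal a).2 M X
  rw [map_sub, LinearMap.sub_apply, sub_eq_zero] at h
  exact h

theorem bivector_inclA (M : so (Fin n) ℝ) (X Y : soA a) :
    bivector M (inclA a X) (inclA a Y) = bivector (projA a M) X Y := by
  rw [bivector_apply, bivector_apply, ← form_inclA]
  rfl

theorem fderiv_comp_projA {s : soA a → ℝ} (hs : ContDiff ℝ (⊤ : ℕ∞) s) (M Y : so (Fin n) ℝ) :
    fderiv ℝ (fun M => s (projA a M)) M Y = fderiv ℝ s (projA a M) (projA a Y) :=
  fderiv_comp_linear hs (projA a) M Y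

theorem grad_comp_projA {s : soA a → ℝ} (hs : ContDiff ℝ (⊤ : ℕ∞) s) (M : so (Fin n) ℝ) :
    grad (fun M => s (projA a M)) M = inclA a (grad s (projA a M)) := by
  refine grad_eq fun Y => ?_
  rw [fderiv_comp_projA hs, form_symm, form_inclA, form_symm, form_grad]

theorem poisson_comp_projA {s s' : soA a → ℝ} (hs : ContDiff ℝ (⊤ : ℕ∞) s)
    (hs' : ContDiff ℝ (⊤ : ℕ∞) s') (M : so (Fin n) ℝ) :
    poisson (fun M => s (projA a M)) (fun M => s' (projA a M)) M = poisson s s' (projA a M) := by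
  rw [poisson, grad_comp_projA hs, grad_comp_projA hs', bivector_inclA, poisson]

theorem poisson_manakovFun_comp_projA {s : soA a → ℝ} (hs : ContDiff ℝ (⊤ : ℕ∞) s) (k : ℕ) (t : ℝ)
    (M : so (Fin n) ℝ) : poisson (manakovFun a k t) (fun M => s (projA a M)) M = 0 := by
  rw [poisson, grad_comp_projA hs, bivector_grad_manakovFun_inclA]

theorem contDiff_comp_projA {s : soA a → ℝ} (hs : ContDiff ℝ (⊤ : ℕ∞) s) :
    ContDiff ℝ (⊤ : ℕ∞) fun M => s (projA a M) :=
  hs.comp (contDiff_of_linear (projA a))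

end Pullback

/-! ### Band matrices -/

section Band

variable {n : ℕ}

/-- The skew-symmetric tridiagonal matrix with entries `1` above the diagonal. -/
def pathSkew (n : ℕ) : so (Fin n) ℝ :=
  ⟨of fun i j => if j.1 = i.1 + 1 then 1 else if i.1 = j.1 + 1 then -1 else 0,
    (mem_so (Fin n) ℝ _).2 (by
      ext i j
      simp only [transpose_apply, of_apply, Matrix.neg_apply]
      split_ifs <;> first | omega | simp)⟩

theorem pathSkew_apply (i j : Fin n) : (pathSkew n).1 i j =
    if j.1 = i.1 + 1 then 1 else if i.1 = j.1 + 1 then -1 else 0 := rfl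

/-- Each factor raises the index by at most one, so reaching `i + d` in `d` steps leaves a single
path; `c j` is the weight of the step into `j`. -/
theorem pow_apply_of_band {T : Matrix (Fin n) (Fin n) ℝ} {c : Fin n → ℝ}
    (h0 : ∀ i j, i.1 + 1 < j.1 → T i j = 0) (h1 : ∀ i j, j.1 = i.1 + 1 → T i j = c j) (d : ℕ) :
    (∀ i j, i.1 + d < j.1 → (T ^ d) i j = 0) ∧
    ∀ i j, j.1 = i.1 + d → (T ^ d) i j = ∏ e ∈ Finset.Ioc i j, c e := by
  induction d with
  | zero =>
    refine ⟨fun i j h => ?_, fun i j h => ?_⟩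
    · rw [pow_zero, one_apply_ne (by rintro rfl; omega)]
    · obtain rfl : i = j := Fin.ext (by omega)
      simp
  | succ d ih =>
    refine ⟨fun i j h => ?_, fun i j h => ?_⟩
    · rw [pow_succ, mul_apply]
      refine Finset.sum_eq_zero fun l _ => ?_
      by_cases hl : i.1 + d < l.1
      · rw [ih.1 i l hl, zero_mul]
      · rw [h0 l j (by omega), mul_zero]
    · rw [pow_succ, mul_apply]
      have hj : j.1 - 1 < n := by omega
      rw [Finset.sum_eq_single ⟨j.1 - 1, hj⟩, ih.2 _ _ (by simp; omega), h1 _ _ (by simp; omega)]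
      · have : Finset.Ioc i j = insert j (Finset.Ioc i ⟨j.1 - 1, hj⟩) := by
          ext e
          simp only [Finset.mem_Ioc, Finset.mem_insert, Fin.lt_def, Fin.le_def, Fin.ext_iff]
          omega
        have hnot : j ∉ Finset.Ioc i ⟨j.1 - 1, hj⟩ := by
          rw [Finset.mem_Ioc, Fin.le_def]
          dsimp only
          omega
        rw [this, Finset.prod_insert hnot, mul_comm]
      · intro l _ hl
        by_cases hl' : i.1 + d < l.1
        · rw [ih.1 i l hl', zero_mul]
        · have : l.1 ≠ j.1 - 1 := fun h' => hl (Fin.ext h')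
          rw [h0 l j (by omega), mul_zero]
      · simp

theorem transpose_pow_of_skew {T : Matrix (Fin n) (Fin n) ℝ} (hT : Tᵀ = -T) {d : ℕ} (hd : Odd d) :
    (T ^ d)ᵀ = -T ^ d := by
  rw [transpose_pow, hT, hd.neg_pow]

end Band

/-! ### Resolvents of the pencil `M + t A` -/

section Resolvent

variable {n : ℕ}

/-- Cayley–Hamilton: reduction modulo the characteristic polynomial leaves degree below `n`. -/
theorem map_aeval_eq_zero {X : Matrix (Fin n) (Fin n) ℝ} {ψ : Matrix (Fin n) (Fin n) ℝ →ₗ[ℝ] ℝ}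
    (h : ∀ k < n, ψ (X ^ k) = 0) (p : Polynomial ℝ) : ψ (Polynomial.aeval X p) = 0 := by
  rcases Nat.eq_zero_or_pos n with rfl | hn
  · rw [Subsingleton.elim (Polynomial.aeval X p) 0, map_zero]
  have : Nonempty (Fin n) := ⟨⟨0, hn⟩⟩
  rw [aeval_eq_aeval_mod_charpoly, Polynomial.aeval_eq_sum_range' (n := n), map_sum]
  · refine Finset.sum_eq_zero fun k hk => ?_
    rw [map_smul, h k (Finset.mem_range.1 hk), smul_zero]
  · have h1 := Polynomial.natDegree_modByMonic_lt p X.charpoly_monic (by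
      intro h1
      have := X.charpoly_natDegree_eq_dim
      rw [h1] at this
      simp at this
      omega)
    simpa [X.charpoly_natDegree_eq_dim] using h1

/-- The inverse is a polynomial in `X`: solve the characteristic equation of `Y` for `Y⁻¹`, the
constant coefficient being nonzero. -/
theorem map_inv_sub_smul_eq_zero {X : Matrix (Fin n) (Fin n) ℝ}
    {ψ : Matrix (Fin n) (Fin n) ℝ →ₗ[ℝ] ℝ} (h : ∀ k < n, ψ (X ^ k) = 0) (c : ℝ)
    (hc : (X - c • (1 : Matrix (Fin n) (Fin n) ℝ)).det ≠ 0) :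
    ψ (X - c • (1 : Matrix (Fin n) (Fin n) ℝ))⁻¹ = 0 := by
  set Y := X - c • (1 : Matrix (Fin n) (Fin n) ℝ) with hY
  have h0 : Y.charpoly.coeff 0 ≠ 0 := by
    intro h0
    rw [det_eq_sign_charpoly_coeff, h0, mul_zero] at hc
    exact hc rfl
  have h1 : Polynomial.aeval Y Y.charpoly.divX * Y = -(Y.charpoly.coeff 0) • 1 := by
    have h2 := aeval_self_charpoly Y
    conv_lhs at h2 => rw [← Polynomial.divX_mul_X_add Y.charpoly]
    rw [map_add, map_mul, Polynomial.aeval_X, Polynomial.aeval_C, Algebra.algebraMap_eq_smul_one] at h2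
    rw [neg_smul]
    exact eq_neg_of_add_eq_zero_left h2
  have h3 : Y⁻¹ = (-(Y.charpoly.coeff 0))⁻¹ • Polynomial.aeval Y Y.charpoly.divX := by
    refine inv_eq_left_inv ?_
    rw [smul_mul_assoc, h1, smul_smul, inv_mul_cancel₀ (neg_ne_zero.2 h0), one_smul]
  have h4 : Polynomial.aeval X (Polynomial.X - Polynomial.C c) = Y := by
    rw [map_sub, Polynomial.aeval_X, Polynomial.aeval_C, Algebra.algebraMap_eq_smul_one]
  rw [h3, map_smul, ← h4, ← Polynomial.aeval_comp, map_aeval_eq_zero h, smul_zero]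

/-- A functional which vanishes on the powers of all matrices `M + t A` vanishes on the
coefficients of the expansion of the resolvents of the pencil. -/
theorem map_resolvent_coeff_eq_zero {M : Matrix (Fin n) (Fin n) ℝ} {a : Fin n → ℝ}
    {ψ : Matrix (Fin n) (Fin n) ℝ →ₗ[ℝ] ℝ}
    (h : ∀ t : ℝ, ∀ k < n, ψ ((M + t • diagonal a) ^ k) = 0) {u : ℝ} (hu : ∀ i, a i ≠ u) (m : ℕ) :
    ψ (diagonal (fun i => (a i - u)⁻¹) * (M * diagonal (fun i => (a i - u)⁻¹)) ^ m) = 0 := by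
  set D : Matrix (Fin n) (Fin n) ℝ := diagonal fun i => a i - u with hD
  set D' : Matrix (Fin n) (Fin n) ℝ := diagonal fun i => (a i - u)⁻¹ with hD'
  have hDD : D * D' = 1 := by
    rw [hD, hD', diagonal_mul_diagonal, ← diagonal_one]
    congr 1
    funext i
    exact mul_inv_cancel₀ (sub_ne_zero.2 (hu i))
  have hdet : D.det ≠ 0 := by
    intro h0
    have := congrArg det hDD
    rw [det_mul, h0, zero_mul, det_one] at this
    exact zero_ne_one this
  have hcont : Continuous fun ε : ℝ => (D + ε • M).det := by fun_prop
  have hinv : ContinuousAt (fun ε : ℝ => (D + ε • M)⁻¹) 0 := by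
    simp only [inv_def, Ring.inverse_eq_inv']
    refine ContinuousAt.smul (ContinuousAt.inv₀ hcont.continuousAt (by simpa using hdet)) ?_
    exact Continuous.continuousAt (by fun_prop)
  have hev : ∀ᶠ ε : ℝ in nhdsWithin 0 {0}ᶜ, ε ≠ 0 ∧ (D + ε • M).det ≠ 0 := by
    refine Filter.Eventually.and self_mem_nhdsWithin (nhdsWithin_le_nhds ?_)
    exact hcont.continuousAt.eventually_ne (by simpa using hdet)
  -- The induction on `m` proves the stronger vanishing with `(D + εM)⁻¹` in place of its value `D'`
  -- at `ε = 0`; the claim is the limit.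
  have hlim : ∀ m : ℕ, (∀ ε : ℝ, ε ≠ 0 → (D + ε • M).det ≠ 0 →
      ψ ((D + ε • M)⁻¹ * (M * D') ^ m) = 0) → ψ (D' * (M * D') ^ m) = 0 := by
    intro m hm
    have hc : ContinuousAt (fun ε : ℝ => ψ ((D + ε • M)⁻¹ * (M * D') ^ m)) 0 :=
      (LinearMap.continuous_of_finiteDimensional ψ).continuousAt.comp
        (hinv.mul continuousAt_const)
    have h1 := hc.tendsto.mono_left (nhdsWithin_le_nhds (s := {0}ᶜ))
    have h2 : Filter.Tendsto (fun ε : ℝ => ψ ((D + ε • M)⁻¹ * (M * D') ^ m))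
        (nhdsWithin 0 {0}ᶜ) (nhds 0) :=
      tendsto_const_nhds.congr' (by
        filter_upwards [hev] with ε hε
        exact (hm ε hε.1 hε.2).symm)
    have h3 := tendsto_nhds_unique h1 h2
    rwa [zero_smul, add_zero, inv_eq_right_inv hDD] at h3
  refine hlim m ?_
  induction m with
  | zero =>
    intro ε hε hdε
    -- Up to the factor `ε`, `D + εM` is the pencil at `t = 1/ε` shifted by the scalar `u/ε`.
    set Y := M + ε⁻¹ • diagonal a - (ε⁻¹ * u) • (1 : Matrix (Fin n) (Fin n) ℝ) with hY
    have h1 : D + ε • M = ε • Y := by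
      have h2 : D = diagonal a - u • (1 : Matrix (Fin n) (Fin n) ℝ) := by
        rw [hD, smul_one_eq_diagonal, diagonal_sub]
      rw [hY, h2, smul_sub, smul_add, smul_smul, smul_smul, mul_inv_cancel_left₀ hε,
        mul_inv_cancel₀ hε, one_smul]
      abel
    have hY0 : Y.det ≠ 0 := by
      intro h0
      rw [h1, det_smul, h0, mul_zero] at hdε
      exact hdε rfl
    have h2 : (D + ε • M)⁻¹ = ε⁻¹ • Y⁻¹ := by
      refine inv_eq_right_inv ?_
      rw [h1, smul_mul_smul_comm, mul_inv_cancel₀ hε, one_smul,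
        mul_nonsing_inv _ (isUnit_iff_ne_zero.2 hY0)]
    rw [pow_zero, mul_one, h2, map_smul, map_inv_sub_smul_eq_zero (h ε⁻¹) _ hY0, smul_zero]
  | succ m ih =>
    intro ε hε hdε
    have h0 := hlim m ih
    -- Resolvent identity: the `D'` term is killed by the limit of the previous case, and the rest
    -- may be divided by `ε`.
    have h1 : (D + ε • M)⁻¹ = D' - ε • ((D + ε • M)⁻¹ * (M * D')) := by
      have h2 : (D + ε • M)⁻¹ * ((D + ε • M) * D') = D' := by
        rw [← mul_assoc, nonsing_inv_mul _ (isUnit_iff_ne_zero.2 hdε), one_mul]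
      rw [add_mul, hDD, smul_mul_assoc, mul_add, mul_one, mul_smul_comm] at h2
      exact eq_sub_of_add_eq h2
    have h2 := ih ε hε hdε
    rw [h1, sub_mul, map_sub, h0, smul_mul_assoc, map_smul, mul_assoc, ← pow_succ', zero_sub,
      neg_eq_zero, smul_eq_mul] at h2
    exact (mul_eq_zero.1 h2).resolve_left hε

end Resolvent

/-! ### Independence of the Manakov integrals modulo the isotropy algebra -/

section Independence

variable {n : ℕ}

/-- Equal entries of `a` are consecutive. -/
def IsBlockwise (a : Fin n → ℝ) : Prop :=
  ∀ i j k, i ≤ j → j ≤ k → a i = a k → a j = a i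

/-- A leading-pole argument in `u`: once the coefficients of smaller row index are zero, clearing
denominators and setting `u = a i` isolates `γ i j`. -/
theorem band_eq_zero {a : Fin n → ℝ} (ha : IsBlockwise a) {γ : Fin n → Fin n → ℝ}
    (hγ : ∀ i j, γ i j ≠ 0 → a i ≠ a j) {d : ℕ}
    (h : ∀ u, (∀ i, a i ≠ u) → ∑ i, ∑ j, (if j.1 = i.1 + d then
      γ i j * ∏ e ∈ Finset.Icc i j, (a e - u)⁻¹ else 0) = 0) (i j : Fin n) (hij : j.1 = i.1 + d) :
    γ i j = 0 := by
  induction hi : i.1 using Nat.strong_induction_on generalizing i j with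
  | _ N ih =>
  by_contra hne
  have hlow : ∀ i' j' : Fin n, i' < i → j'.1 = i'.1 + d → γ i' j' = 0 := fun i' j' h1 h2 =>
    ih i'.1 (by rw [← hi]; exact h1) i' j' h2 rfl
  let P : ℝ → ℝ := fun u => ∑ i', ∑ j', (if j'.1 = i'.1 + d then
    γ i' j' * ∏ e ∈ Finset.Ici i \ Finset.Icc i' j', (a e - u) else 0)
  have hP : ∀ u, (∀ i, a i ≠ u) → P u = 0 := by
    intro u hu
    rw [← mul_zero (∏ e ∈ Finset.Ici i, (a e - u)), ← h u hu]
    simp only [P, Finset.mul_sum]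
    refine Finset.sum_congr rfl fun i' _ => Finset.sum_congr rfl fun j' _ => ?_
    split_ifs with hd
    · rcases lt_or_ge i' i with hlt | hge
      · rw [hlow i' j' hlt hd]
        simp
      · have hsub : Finset.Icc i' j' ⊆ Finset.Ici i := fun e he =>
          Finset.mem_Ici.2 (hge.trans (Finset.mem_Icc.1 he).1)
        rw [← Finset.prod_sdiff hsub, Finset.prod_inv_distrib]
        have : ∏ e ∈ Finset.Icc i' j', (a e - u) ≠ 0 :=
          Finset.prod_ne_zero_iff.2 fun e _ => sub_ne_zero.2 (hu e)
        field_simp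
    · rw [mul_zero]
  have hPc : Continuous P := by
    refine continuous_finsetSum _ fun i' _ => continuous_finsetSum _ fun j' _ => ?_
    split_ifs
    · fun_prop
    · exact continuous_const
  have hdense : Dense {u : ℝ | ∀ i, a i ≠ u} := by
    have : {u : ℝ | ∀ i, a i ≠ u} = (Set.range a)ᶜ := by
      ext u
      simp
    rw [this]
    exact (Set.finite_range a).countable.dense_compl ℝ
  have hP0 : P (a i) = 0 := congrFun (hPc.ext_on hdense continuous_const hP) (a i)
  have hPi : P (a i) = γ i j * ∏ e ∈ Finset.Ici i \ Finset.Icc i j, (a e - a i) := by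
    simp only [P]
    rw [Finset.sum_eq_single i, Finset.sum_eq_single j, if_pos hij]
    · intro j' _ hj'
      rw [if_neg fun h' => hj' (Fin.ext (by omega))]
    · simp
    · intro i' _ hi'
      refine Finset.sum_eq_zero fun j' _ => ?_
      split_ifs with hd
      · rcases lt_or_gt_of_ne hi' with hlt | hgt
        · rw [hlow i' j' hlt hd, zero_mul]
        -- For `i' > i` the factor with `e = i` is not cancelled, and it vanishes at `u = a i`.
        · rw [Finset.prod_eq_zero (i := i), mul_zero]
          · simp only [Finset.mem_sdiff, Finset.mem_Ici, Finset.mem_Icc, le_refl, true_and,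
              not_and_or, not_le]
            exact Or.inl hgt
          · exact sub_self _
      · rfl
    · simp
  rw [hPi] at hP0
  -- The surviving factors have `e > j`; a zero one would put `j` in the block of `i`.
  refine (mul_ne_zero hne (Finset.prod_ne_zero_iff.2 fun e he => sub_ne_zero.2 fun hea => ?_)) hP0
  simp only [Finset.mem_sdiff, Finset.mem_Ici, Finset.mem_Icc, not_and, not_le] at he
  exact hγ i j hne (ha i j e (by rw [Fin.le_def]; omega) (he.2 he.1).le hea.symm).symm

theorem resolvent_coeff_apply (w : Fin n → ℝ) (d : ℕ) (i j : Fin n) :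
    (i.1 + d < j.1 → (diagonal w * ((pathSkew n).1 * diagonal w) ^ d) i j = 0) ∧
    (j.1 = i.1 + d → (diagonal w * ((pathSkew n).1 * diagonal w) ^ d) i j =
      ∏ e ∈ Finset.Icc i j, w e) := by
  have h := pow_apply_of_band (T := (pathSkew n).1 * diagonal w) (c := w)
    (fun i j hij => by
      rw [mul_diagonal, pathSkew_apply, if_neg (by omega), if_neg (by omega), zero_mul])
    (fun i j hij => by rw [mul_diagonal, pathSkew_apply, if_pos hij, one_mul]) d
  refine ⟨fun hij => ?_, fun hij => ?_⟩
  · rw [diagonal_mul, h.1 i j hij, mul_zero]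
  · rw [diagonal_mul, h.2 i j hij, ← Finset.Ioc_insert_left (Fin.le_def.2 (by omega)),
      Finset.prod_insert Finset.left_notMem_Ioc]

/-- The word is a palindrome in `diagonal w` and `M`, so transposition only contributes `(-1)^d`. -/
theorem transpose_resolvent_coeff {M : Matrix (Fin n) (Fin n) ℝ} (hM : Mᵀ = -M) (w : Fin n → ℝ)
    {d : ℕ} (hd : Odd d) :
    (diagonal w * (M * diagonal w) ^ d)ᵀ = -(diagonal w * (M * diagonal w) ^ d) := by
  rw [transpose_mul, transpose_pow, transpose_mul, diagonal_transpose, hM, mul_neg, hd.neg_pow,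
    neg_mul]
  congr 1
  have : SemiconjBy (diagonal w) (M * diagonal w) (diagonal w * M) := by
    rw [SemiconjBy, mul_assoc]
  exact (this.pow_right d).symm

/-- Induction on the distance `d`. The `d`-th resolvent coefficient has no entries further than `d`
above the diagonal, and `γ` already vanishes at smaller distances, so only the band at distance `d`
remains. -/
theorem coefficients_eq_zero {a : Fin n → ℝ} (ha : IsBlockwise a) {γ : Fin n → Fin n → ℝ}
    (hγ : ∀ i j, γ i j ≠ 0 → i < j ∧ Odd (j.1 - i.1) ∧ a i ≠ a j)
    (h : ∀ t : ℝ, ∀ k < n, ∑ i, ∑ j, γ i j * (((pathSkew n).1 + t • diagonal a) ^ k -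
      (((pathSkew n).1 + t • diagonal a) ^ k)ᵀ) i j = 0) : γ = 0 := by
  let ψ : Matrix (Fin n) (Fin n) ℝ →ₗ[ℝ] ℝ :=
    { toFun := fun G => ∑ i, ∑ j, γ i j * (G - Gᵀ) i j
      map_add' := fun G H => by
        simp only [← Finset.sum_add_distrib, Matrix.sub_apply, Matrix.add_apply, transpose_apply]
        exact Finset.sum_congr rfl fun i _ => Finset.sum_congr rfl fun j _ => by ring
      map_smul' := fun c G => by
        simp only [Finset.mul_sum, Matrix.sub_apply, Matrix.smul_apply, transpose_apply,
          smul_eq_mul, RingHom.id_apply]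
        exact Finset.sum_congr rfl fun i _ => Finset.sum_congr rfl fun j _ => by ring }
  have key : ∀ d : ℕ, ∀ i j : Fin n, j.1 = i.1 + d → γ i j = 0 := by
    intro d
    induction d using Nat.strong_induction_on with
    | _ d ih =>
    by_cases hd : Odd d
    swap
    · intro i j hij
      by_contra hne
      refine hd ?_
      have := (hγ i j hne).2.1
      rwa [hij, Nat.add_sub_cancel_left] at this
    refine band_eq_zero ha (fun i j hne => (hγ i j hne).2.2) fun u hu => ?_
    have h1 : ψ _ = 0 := map_resolvent_coeff_eq_zero h hu d
    simp only [ψ, LinearMap.coe_mk, AddHom.coe_mk,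
      transpose_resolvent_coeff (transpose_coe_so (pathSkew n)) _ hd, sub_neg_eq_add] at h1
    have h2 : (2 : ℝ) * ∑ i, ∑ j : Fin n, (if j.1 = i.1 + d then
        γ i j * ∏ e ∈ Finset.Icc i j, (a e - u)⁻¹ else 0) = 0 := by
      refine Eq.trans ?_ h1
      rw [Finset.mul_sum]
      refine Finset.sum_congr rfl fun i _ => ?_
      rw [Finset.mul_sum]
      refine Finset.sum_congr rfl fun j _ => ?_
      have hR := resolvent_coeff_apply (fun i => (a i - u)⁻¹) d i j
      rw [Matrix.add_apply]
      split_ifs with hij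
      · rw [hR.2 hij]
        ring
      · rcases lt_or_ge (i.1 + d) j.1 with hlt | hge
        · rw [hR.1 hlt]
          simp
        · have : γ i j = 0 := by
            by_contra hne
            have hlt := (hγ i j hne).1
            rw [Fin.lt_def] at hlt
            exact hne (ih (j.1 - i.1) (by omega) i j (by omega))
          rw [this]
          simp
    linarith
  funext i j
  by_contra hne
  have hlt := (hγ i j hne).1
  rw [Fin.lt_def] at hlt
  exact hne (key (j.1 - i.1) i j (by omega))

/-- Pairs of indices in different blocks at odd distance. -/
abbrev OddPair (a : Fin n → ℝ) : Type :=
  {p : Fin n × Fin n // p.1 < p.2 ∧ Odd (p.2.1 - p.1.1) ∧ a p.1 ≠ a p.2}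

/-- The component of a skew-symmetric matrix in `𝔳`. -/
noncomputable def complA (a : Fin n → ℝ) : so (Fin n) ℝ →ₗ[ℝ] so (Fin n) ℝ :=
  LinearMap.id - inclA a ∘ₗ projA a

theorem complA_apply (a : Fin n → ℝ) (M : so (Fin n) ℝ) :
    complA a M = M - inclA a (projA a M) := rfl

theorem complA_inclA (a : Fin n → ℝ) (X : soA a) : complA a (inclA a X) = 0 := by
  rw [complA_apply, (projA_orthogonal a).1, sub_self]

theorem complA_apply_apply {a : Fin n → ℝ} (M : so (Fin n) ℝ) {i j : Fin n} (h : a i ≠ a j) :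
    (complA a M).1 i j = M.1 i j := by
  simp [complA_apply, inclA, projA, h]

/-- There are as many independent Manakov integrals modulo `so(n)_A` as odd pairs. -/
theorem exists_manakovFun_linearIndependent {a : Fin n → ℝ} (ha : IsBlockwise a) :
    ∃ (κ : OddPair a → ℕ) (τ : OddPair a → ℝ), (∀ p, κ p ∈ Finset.Icc 1 n) ∧
      LinearIndependent ℝ fun p => complA a (grad (manakovFun a (κ p) (τ p)) (pathSkew n)) := by
  classical
  let r : so (Fin n) ℝ →ₗ[ℝ] OddPair a → ℝ :=
    LinearMap.pi fun p => ((LinearMap.proj p.1.2).comp (LinearMap.proj p.1.1)).comp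
      (so (Fin n) ℝ).toSubmodule.subtype
  let g : Fin n × ℝ → OddPair a → ℝ := fun x =>
    r (skewPart (((pathSkew n).1 + x.2 • diagonal a) ^ x.1.1))
  -- A functional killing the span, read as a matrix supported on odd pairs, would contradict
  -- `coefficients_eq_zero`.
  have htop : Submodule.span ℝ (Set.range g) = ⊤ := by
    by_contra hne
    obtain ⟨f, hf0, hf⟩ := Submodule.exists_le_ker_of_lt_top _ (lt_top_iff_ne_top.2 hne)
    have hsum : ∀ x : OddPair a → ℝ, f x = ∑ p, f (Pi.single p 1) * x p := by
      intro x
      conv_lhs => rw [pi_eq_sum_univ' x]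
      simp only [map_sum, map_smul, smul_eq_mul]
      refine Finset.sum_congr rfl fun p _ => ?_
      rw [mul_comm]
    let γ : Fin n → Fin n → ℝ := fun i j =>
      if h : i < j ∧ Odd (j.1 - i.1) ∧ a i ≠ a j then f (Pi.single ⟨(i, j), h⟩ 1) else 0
    have hγ : γ = 0 := by
      refine coefficients_eq_zero ha (fun i j hne => ?_) fun t k hk => ?_
      · by_contra h
        exact hne (dif_neg h)
      · have h1 : f (g (⟨k, hk⟩, t)) = 0 := hf (Submodule.subset_span ⟨_, rfl⟩)
        rw [hsum] at h1
        rw [← Finset.sum_product', Finset.univ_product_univ]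
        refine (Fintype.sum_of_injective Subtype.val Subtype.val_injective _ _ (fun p hp => ?_)
          fun p => ?_).symm.trans h1
        · have hp' : ¬(p.1 < p.2 ∧ Odd (p.2.1 - p.1.1) ∧ a p.1 ≠ a p.2) := fun h' =>
            hp ⟨⟨p, h'⟩, rfl⟩
          simp only [γ]
          rw [dif_neg hp', zero_mul]
        · simp only [γ]
          rw [dif_pos p.2]
          rfl
    refine hf0 (LinearMap.ext fun x => ?_)
    rw [hsum, LinearMap.zero_apply]
    refine Finset.sum_eq_zero fun p _ => ?_
    have h1 := congrFun (congrFun hγ p.1.1) p.1.2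
    simp only [γ, dif_pos p.2, Pi.zero_apply] at h1
    rw [show p = ⟨(p.1.1, p.1.2), p.2⟩ from rfl, h1, zero_mul]
  obtain ⟨b, hb, hbs, hbi⟩ := exists_linearIndependent ℝ (Set.range g)
  let B : Basis b ℝ (OddPair a → ℝ) := Basis.mk hbi (by
    rw [Subtype.range_coe, hbs, htop])
  let e : OddPair a ≃ b := (Pi.basisFun ℝ (OddPair a)).indexEquiv B
  choose x hx using fun p => hb (e p).2
  -- The shift by one is the exponent lost in the gradient; the scalar `-(k + 1)` that appears is a
  -- unit.
  refine ⟨fun p => (x p).1.1 + 1, fun p => (x p).2, fun p => ?_, ?_⟩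
  · exact Finset.mem_Icc.2 ⟨Nat.le_add_left _ _, (x p).1.2⟩
  · refine LinearIndependent.of_comp r ?_
    have h1 : LinearIndependent ℝ fun p => g (x p) := by
      simp only [hx]
      exact hbi.comp e e.injective
    have h2 := h1.units_smul fun p => Units.mk0 (-((x p).1.1 + 1 : ℕ) : ℝ)
      (neg_ne_zero.2 (Nat.cast_ne_zero.2 (Nat.succ_ne_zero _)))
    convert h2 using 1
    funext p
    funext q
    simp only [Function.comp_apply, r, LinearMap.pi_apply, LinearMap.comp_apply]
    change (complA a _).1 q.1.1 q.1.2 = _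
    rw [complA_apply_apply _ q.2.2.2, grad_manakovFun]
    rfl

end Independence

/-! ### Bounds for the coranks -/

section Corank

variable {n : ℕ}

/-- Polynomials in `M` which map the first basis vector to the other ones if `M = pathSkew n`. -/
def pathPoly (M : Matrix (Fin n) (Fin n) ℝ) : ℕ → Matrix (Fin n) (Fin n) ℝ
  | 0 => 1
  | 1 => -M
  | j + 2 => pathPoly M j - M * pathPoly M (j + 1)

theorem commute_pathPoly {M X : Matrix (Fin n) (Fin n) ℝ} (h : Commute X M) (j : ℕ) :
    Commute X (pathPoly M j) := by
  induction j using Nat.twoStepInduction with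
  | zero => exact Commute.one_right X
  | one => exact h.neg_right
  | more j h1 h2 => exact h1.sub_right (h.mul_right h2)

/-- `pathPoly M j` is a polynomial in `M` of the parity of `j`. -/
theorem transpose_pathPoly {M : Matrix (Fin n) (Fin n) ℝ} (hM : Mᵀ = -M) (j : ℕ) :
    (pathPoly M j)ᵀ = (-1 : ℝ) ^ j • pathPoly M j := by
  induction j using Nat.twoStepInduction with
  | zero => simp [pathPoly]
  | one => simp [pathPoly, hM]
  | more j h1 h2 =>
    rw [pathPoly, transpose_sub, transpose_mul, h1, h2, hM, mul_neg, smul_mul_assoc,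
      ← (commute_pathPoly (Commute.refl M) (j + 1)).eq, show (-1 : ℝ) ^ (j + 2) = (-1) ^ j by
        rw [pow_add]; norm_num, smul_sub, pow_succ]
    simp

/-- The recursion solves `T e_{j+1} = e_j - e_{j+2}` and `T e_0 = -e_1` for `T = pathSkew n`. -/
theorem pathPoly_apply_zero (hn : 0 < n) (j : ℕ) (hj : j < n) (i : Fin n) :
    pathPoly (pathSkew n).1 j i ⟨0, hn⟩ = if i.1 = j then 1 else 0 := by
  induction j using Nat.twoStepInduction generalizing i with
  | zero => simp [pathPoly, Matrix.one_apply, Fin.ext_iff]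
  | one =>
    simp [pathPoly, pathSkew_apply]
    split_ifs <;> simp
  | more j h1 h2 =>
    rw [pathPoly, Matrix.sub_apply, h1 (by omega), mul_apply,
      Finset.sum_eq_single ⟨j + 1, by omega⟩, h2 (by omega), pathSkew_apply]
    · dsimp only
      split_ifs <;> first | omega | simp
    · intro l _ hl
      rw [h2 (by omega), if_neg fun h => hl (Fin.ext h), mul_zero]
    · simp

/-- A matrix which commutes with `pathSkew n` is determined by its first column. -/
theorem eq_sum_pathPoly (hn : 0 < n) {X : Matrix (Fin n) (Fin n) ℝ}
    (h : Commute X (pathSkew n).1) :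
    X = ∑ j : Fin n, X j ⟨0, hn⟩ • pathPoly (pathSkew n).1 j := by
  set Y := ∑ j : Fin n, X j ⟨0, hn⟩ • pathPoly (pathSkew n).1 j with hY
  have hYc : Commute Y (pathSkew n).1 :=
    Commute.sum_left _ _ _ fun j _ =>
      ((commute_pathPoly (Commute.refl _) j).symm).smul_left _
  -- Column `j` of `Z` is `Z p_j(T) e_0 = p_j(T) Z e_0`.
  have hcol : ∀ Z : Matrix (Fin n) (Fin n) ℝ, Commute Z (pathSkew n).1 → ∀ i j : Fin n,
      Z i j = ∑ l, pathPoly (pathSkew n).1 j i l * Z l ⟨0, hn⟩ := by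
    intro Z hZ i j
    rw [← mul_apply, ← (commute_pathPoly hZ j).eq, mul_apply, Finset.sum_eq_single j,
      pathPoly_apply_zero hn j j.2, if_pos rfl, mul_one]
    · intro l _ hl
      rw [pathPoly_apply_zero hn j j.2, if_neg fun h => hl (Fin.ext h), mul_zero]
    · simp
  have h0 : ∀ l, Y l ⟨0, hn⟩ = X l ⟨0, hn⟩ := by
    intro l
    rw [hY, Matrix.sum_apply, Finset.sum_eq_single l, Matrix.smul_apply,
      pathPoly_apply_zero hn l l.2, if_pos rfl, smul_eq_mul, mul_one]
    · intro j _ hj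
      rw [Matrix.smul_apply, pathPoly_apply_zero hn j j.2, if_neg fun h => hj (Fin.ext h.symm),
        smul_zero]
    · simp
  ext i j
  rw [hcol X h, hcol Y hYc]
  simp only [h0]

/-- A skew matrix commuting with `pathSkew n` is determined by the odd entries of its first column:
if they vanish, only symmetric `pathPoly` terms remain. -/
theorem corank_so_le : corank (so (Fin n) ℝ) ≤ Nat.card {j : Fin n // Odd j.1} := by
  classical
  refine (corank_le (pathSkew n)).trans ?_
  rcases Nat.eq_zero_or_pos n with rfl | hn
  · rw [finrank_zero_of_subsingleton]
    exact Nat.zero_le _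
  let T : LinearMap.ker (bivector (pathSkew n)) →ₗ[ℝ] {j : Fin n // Odd j.1} → ℝ :=
    LinearMap.pi fun p => (((LinearMap.proj ⟨0, hn⟩).comp (LinearMap.proj p.1)).comp
      (so (Fin n) ℝ).toSubmodule.subtype).comp (Submodule.subtype _)
  have hT : Function.Injective T := by
    rw [← LinearMap.ker_eq_bot]
    refine LinearMap.ker_eq_bot'.2 fun X hX => ?_
    have hodd : ∀ j : Fin n, Odd j.1 → X.1.1 j ⟨0, hn⟩ = 0 := fun j hj => congrFun hX ⟨j, hj⟩
    have hc : Commute X.1.1 (pathSkew n).1 := by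
      have := congrArg Subtype.val (mem_ker_bivector.1 X.2)
      rw [LieSubalgebra.coe_bracket, Ring.lie_def] at this
      exact (sub_eq_zero.1 this).symm
    have h1 := eq_sum_pathPoly hn hc
    have h2 : X.1.1ᵀ = X.1.1 := by
      rw [h1, transpose_sum]
      refine Finset.sum_congr rfl fun j _ => ?_
      rcases Nat.even_or_odd j.1 with hj | hj
      · rw [transpose_smul, transpose_pathPoly (transpose_coe_so _), hj.neg_one_pow, one_smul]
      · rw [hodd j hj, zero_smul, transpose_zero]
    rw [transpose_coe_so] at h2
    refine Subtype.ext (Subtype.ext (Matrix.ext fun i j => ?_))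
    have h3 : -X.1.1 i j = X.1.1 i j := congrFun (congrFun h2 i) j
    exact neg_eq_self.1 h3
  rw [Nat.card_eq_fintype_card]
  simpa using LinearMap.finrank_le_finrank_of_injective hT

/-- The first index of the block of `j`. -/
noncomputable def blockStart (a : Fin n → ℝ) (j : Fin n) : Fin n :=
  (Finset.univ.filter fun i => a i = a j).min' ⟨j, by simp⟩

variable {a : Fin n → ℝ}

theorem apply_blockStart (j : Fin n) : a (blockStart a j) = a j :=
  (Finset.mem_filter.1 (Finset.min'_mem (Finset.univ.filter fun i => a i = a j) ⟨j, by simp⟩)).2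

theorem blockStart_le {i j : Fin n} (h : a i = a j) : blockStart a j ≤ i :=
  Finset.min'_le _ _ (by simpa using h)

theorem blockStart_congr {i j : Fin n} (h : a i = a j) : blockStart a i = blockStart a j :=
  le_antisymm (blockStart_le ((apply_blockStart j).trans h.symm))
    (blockStart_le ((apply_blockStart i).trans h))

theorem IsBlockwise.lt_blockStart_iff (ha : IsBlockwise a) {i j : Fin n} (hij : i ≤ j) :
    i < blockStart a j ↔ a i ≠ a j := by
  constructor
  · intro h h'
    exact absurd (blockStart_le h') (not_le.2 h)
  · intro h
    by_contra h'
    exact h ((ha _ i j (not_lt.1 h') hij (apply_blockStart j)).trans (apply_blockStart j))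

/-- The odd powers of the diagonal blocks of `N ∈ so(n)_A`, up to a factor. -/
noncomputable def blockPow (a : Fin n → ℝ) (j : Fin n) (d : ℕ) (N : soA a) : soA a :=
  projA a (skewPart (diagonal (fun i => if a i = a j then 1 else 0) * N.1 ^ d))

theorem soA_apply_eq_zero (N : soA a) {i j : Fin n} (h : a i ≠ a j) : N.1 i j = 0 := by
  have h1 := congrFun (congrFun N.2.2 i) j
  rw [Ring.lie_def, Matrix.sub_apply, mul_diagonal, diagonal_mul] at h1
  have h2 : (a j - a i) * N.1 i j = 0 := by
    rw [sub_mul, mul_comm (a j)]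
    exact h1
  exact (mul_eq_zero.1 h2).resolve_left (sub_ne_zero.2 (Ne.symm h))

theorem commute_soA_diagonal (N : soA a) {c : Fin n → ℝ} (hc : ∀ i j, a i = a j → c i = c j) :
    Commute N.1 (diagonal c) := by
  ext i j
  rw [mul_diagonal, diagonal_mul]
  by_cases h : a i = a j
  · rw [hc i j h, mul_comm]
  · rw [soA_apply_eq_zero N h, zero_mul, mul_zero]

/-- The product inside commutes with `N` and `A`, and so does its transpose; the skew part is thus
already in `so(n)_A`, and `projA` only fixes the type. -/
theorem lie_blockPow (j : Fin n) (d : ℕ) (N : soA a) : ⁅N, blockPow a j d N⁆ = 0 := by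
  set E : Matrix (Fin n) (Fin n) ℝ := diagonal (fun i => if a i = a j then 1 else 0) with hE
  have hNE : Commute N.1 E := commute_soA_diagonal N fun i i' h => by rw [h]
  have hNA : Commute N.1 (diagonal a) := commute_soA_diagonal N fun i i' h => h
  have hEA : Commute E (diagonal a) := by
    rw [Commute, SemiconjBy, hE, diagonal_mul_diagonal, diagonal_mul_diagonal]
    simp only [mul_comm]
  have hN : N.1ᵀ = -N.1 := transpose_coe_so ⟨N.1, N.2.1⟩
  have hYN : Commute N.1 (E * N.1 ^ d) := hNE.mul_right ((Commute.refl _).pow_right d)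
  have hYA : Commute (diagonal a) (E * N.1 ^ d) := hEA.symm.mul_right (hNA.symm.pow_right d)
  have hproj : ∀ Y : Matrix (Fin n) (Fin n) ℝ, Commute N.1 Y → Commute (diagonal a) Y →
      ⁅N, projA a (skewPart Y)⁆ = 0 := by
    intro Y hYN hYA
    have hYN' : Commute N.1 Yᵀ := by
      have := congrArg transpose hYN.eq
      rw [transpose_mul, transpose_mul, hN, mul_neg, neg_mul, neg_inj] at this
      exact this.symm
    have hYA' : Commute (diagonal a) Yᵀ := by
      have := congrArg transpose hYA.eq
      rw [transpose_mul, transpose_mul, diagonal_transpose] at this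
      exact this.symm
    have hmem : (skewPart Y).1 ∈ soA a := by
      refine ⟨(skewPart Y).2, ?_⟩
      rw [coe_skewPart, Ring.lie_def, sub_eq_zero]
      exact (hYA.sub_right hYA').symm.eq
    rw [show projA a (skewPart Y) = ⟨_, hmem⟩ from (projA_orthogonal a).1 ⟨_, hmem⟩]
    refine Subtype.ext ?_
    rw [LieSubalgebra.coe_bracket, coe_skewPart, Ring.lie_def]
    exact sub_eq_zero.2 (hYN.sub_right hYN').eq
  exact hproj _ hYN hYA

theorem contDiff_blockPow {m : WithTop ℕ∞} (j : Fin n) (d : ℕ) :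
    ContDiff ℝ m (blockPow a j d) := by
  let T : Matrix (Fin n) (Fin n) ℝ →ₗ[ℝ] soA a := (projA a ∘ₗ skewPart) ∘ₗ
    LinearMap.mulLeft ℝ (diagonal fun i => if a i = a j then 1 else 0)
  have h : blockPow a j d = fun N : soA a =>
      ∑ i, ∑ l, (N.1 ^ d) i l • T (Matrix.single i l (1 : ℝ)) := by
    funext N
    change T (N.1 ^ d) = _
    conv_lhs => rw [matrix_eq_sum_single (N.1 ^ d)]
    simp only [map_sum, ← map_smul, smul_single, smul_eq_mul, mul_one]
  rw [h]
  exact ContDiff.sum fun i _ => ContDiff.sum fun l _ =>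
    (contDiff_pow_apply contDiff_coe_apply d i l).smul contDiff_const

/-- Indices at odd distance from the beginning of their block. -/
abbrev OddInBlock (a : Fin n → ℝ) : Type := {j : Fin n // Odd (j.1 - (blockStart a j).1)}

/-- Triangularity: the entry from the start of the block to `j` is `2` for the `j`-th matrix. For
smaller `i` it is zero, because the power is too low or the block is another one. -/
theorem linearIndependent_blockPow (ha : IsBlockwise a) :
    LinearIndependent ℝ fun j : OddInBlock a =>
      blockPow a j.1 (j.1.1 - (blockStart a j.1).1) (projA a (pathSkew n)) := by
  classical
  set N := projA a (pathSkew n) with hN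
  have hNt : N.1ᵀ = -N.1 := transpose_coe_so ⟨N.1, N.2.1⟩
  have hNa : ∀ i j, N.1 i j = if a i = a j then (pathSkew n).1 i j else 0 := fun i j => rfl
  let c : Fin n → ℝ := fun j => N.1 ⟨j.1 - 1, by omega⟩ j
  have hband := pow_apply_of_band (T := N.1) (c := c)
    (fun i j hij => by
      have : (pathSkew n).1 i j = 0 := by
        rw [pathSkew_apply, if_neg (by omega), if_neg (by omega)]
      rw [hNa, this, ite_self])
    (fun i j hij => by
      have : i = ⟨j.1 - 1, by omega⟩ := Fin.ext (by simp [hij])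
      simp only [c]
      rw [← this])
  have hentry : ∀ (j l : Fin n) (d : ℕ), Odd d → a l = a j →
      (blockPow a j d N).1 (blockStart a l) l = 2 * (N.1 ^ d) (blockStart a l) l := by
    intro j l d hd hl
    have hs := apply_blockStart (a := a) l
    have h1 : (N.1 ^ d) l (blockStart a l) = -(N.1 ^ d) (blockStart a l) l :=
      congrFun (congrFun (transpose_pow_of_skew hNt hd) (blockStart a l)) l
    change (if a (blockStart a l) = a l then (skewPart _).1 (blockStart a l) l else 0) = _
    rw [if_pos hs, coe_skewPart, Matrix.sub_apply, transpose_apply, diagonal_mul, diagonal_mul,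
      if_pos (hs.trans hl), if_pos hl, h1]
    ring
  rw [Fintype.linearIndependent_iff]
  intro g hg
  by_contra hne
  push Not at hne
  obtain ⟨j, hj, hmax⟩ := (Finset.univ.filter fun j : OddInBlock a => g j ≠ 0).exists_max_image
    (fun j => j.1) (by obtain ⟨j, hj⟩ := hne; exact ⟨j, by simpa using hj⟩)
  have hgj : g j ≠ 0 := (Finset.mem_filter.1 hj).2
  have h1 : (∑ i, g i • blockPow a i.1 (i.1.1 - (blockStart a i.1).1) N).1
      (blockStart a j.1) j.1 = 0 := by
    rw [hg]
    rfl
  have h2 : (∑ i, g i • blockPow a i.1 (i.1.1 - (blockStart a i.1).1) N).1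
      (blockStart a j.1) j.1 =
      ∑ i, g i * (blockPow a i.1 (i.1.1 - (blockStart a i.1).1) N).1 (blockStart a j.1) j.1 := by
    change (soA a).toSubmodule.subtype (∑ i, _) _ _ = _
    rw [map_sum, Matrix.sum_apply]
    rfl
  have hjs : (blockStart a j.1).1 ≤ j.1.1 := blockStart_le rfl
  rw [h2, Finset.sum_eq_single j, hentry _ _ _ j.2 rfl, (hband _).2 _ _ (by omega),
    Finset.prod_eq_one] at h1
  · exact hgj (by linarith)
  · intro e he
    rw [Finset.mem_Ioc, Fin.lt_def, Fin.le_def] at he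
    have h3 : a e = a (blockStart a j.1) :=
      ha _ e j.1 (by rw [Fin.le_def]; omega) (by rw [Fin.le_def]; omega) (apply_blockStart _)
    have h4 : a ⟨e.1 - 1, by omega⟩ = a (blockStart a j.1) :=
      ha _ _ j.1 (by rw [Fin.le_def]; dsimp only; omega) (by rw [Fin.le_def]; dsimp only; omega)
        (apply_blockStart _)
    simp only [c]
    rw [hNa, if_pos (h4.trans h3.symm), pathSkew_apply, if_pos (by dsimp only; omega)]
  · intro i _ hij
    by_cases hgi : g i = 0
    · rw [hgi, zero_mul]
    have hle : i.1 ≤ j.1 := hmax i (by simpa using hgi)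
    have hlt : i.1 < j.1 := lt_of_le_of_ne hle fun h => hij (Subtype.ext h)
    rw [Fin.lt_def] at hlt
    by_cases hb : a j.1 = a i.1
    · have hst := blockStart_congr hb
      have his : (blockStart a i.1).1 ≤ i.1.1 := blockStart_le rfl
      rw [hentry _ _ _ i.2 hb, (hband _).1 _ _ (by rw [hst]; omega), mul_zero, mul_zero]
    · have hb' : a (blockStart a j.1) ≠ a i.1 := by
        rwa [apply_blockStart (a := a)]
      change g i * (if _ then (skewPart _).1 (blockStart a j.1) j.1 else 0) = 0
      rw [coe_skewPart, Matrix.sub_apply, transpose_apply, diagonal_mul, diagonal_mul, if_neg hb,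
        if_neg hb']
      simp
  · simp

/-- The corank is a minimum, so independent kernel elements are needed at a point that attains it;
two open dense sets are intersected. -/
theorem card_oddInBlock_le_corank (ha : IsBlockwise a) :
    Nat.card (OddInBlock a) ≤ corank (soA a) := by
  classical
  obtain ⟨U, hU, hU', h⟩ := exists_dense_linearIndependent
    (fun j : OddInBlock a => contDiff_blockPow j.1 _) (linearIndependent_blockPow ha)
  obtain ⟨V, hV, hV', h'⟩ := exists_dense_finrank_ker_eq (𝔤 := soA a)
  obtain ⟨N, hNU, hNV⟩ := (hU'.inter_of_isOpen_left hV' hU).nonempty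
  rw [← h' N hNV]
  have hmem : ∀ j : OddInBlock a, blockPow a j.1 (j.1.1 - (blockStart a j.1).1) N ∈
      LinearMap.ker (bivector N) := fun j => mem_ker_bivector.2 (lie_blockPow _ _ _)
  have h1 : LinearIndependent ℝ fun j : OddInBlock a =>
      (⟨_, hmem j⟩ : LinearMap.ker (bivector N)) :=
    LinearIndependent.of_comp (Submodule.subtype _) (h N hNU)
  rw [Nat.card_eq_fintype_card]
  exact h1.fintype_card_le_finrank

end Corank

/-! ### The dimension count -/

section Count

variable {n : ℕ} {a : Fin n → ℝ}

/-- The alternating sum of `(-1)^(j-i)` over `i < f` telescopes. -/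
theorem count_parity (j f : ℕ) (hf : f ≤ j) :
    (if Odd j then 1 else 0) + ∑ i ∈ Finset.range f, (if Even (j - i) then 1 else 0) =
      (∑ i ∈ Finset.range f, if Odd (j - i) then 1 else 0) + if Odd (j - f) then 1 else 0 := by
  induction f with
  | zero => simp
  | succ f ih =>
    have ih := ih (by omega)
    rw [Finset.sum_range_succ, Finset.sum_range_succ]
    have h1 : Odd (j - f) ↔ ¬Odd (j - (f + 1)) := by
      rw [show j - f = j - (f + 1) + 1 by omega, Nat.odd_add_one]
    have h2 : Even (j - f) ↔ Odd (j - (f + 1)) := by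
      rw [← Nat.not_odd_iff_even, h1, not_not]
    by_cases h : Odd (j - (f + 1))
    · rw [if_neg (fun h' => h1.1 h' h)] at ih ⊢
      rw [if_pos (h2.2 h), if_pos h]
      omega
    · rw [if_pos (h1.2 h)] at ih ⊢
      rw [if_neg (fun h' => h (h2.1 h')), if_neg h]
      omega

/-- Pairs of indices in different blocks. -/
abbrev DistinctPair (a : Fin n → ℝ) : Type :=
  {p : Fin n × Fin n // p.1 < p.2 ∧ a p.1 ≠ a p.2}

/-- The partners of `j` in earlier blocks are exactly the indices below its block start; sum
`count_parity` over `j`. -/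
theorem card_pairs (ha : IsBlockwise a) :
    Nat.card {j : Fin n // Odd j.1} + Nat.card (DistinctPair a) =
      2 * Nat.card (OddPair a) + Nat.card (OddInBlock a) := by
  classical
  have hsum : ∀ (j : Fin n) (P : ℕ → Prop) [DecidablePred P],
      (∑ i : Fin n, if i < j ∧ P (j.1 - i.1) ∧ a i ≠ a j then 1 else 0) =
        ∑ i ∈ Finset.range (blockStart a j).1, if P (j.1 - i) then 1 else 0 := by
    intro j P _
    have hj : blockStart a j ≤ j := blockStart_le rfl
    rw [Finset.sum_range fun i => if P (j.1 - i) then 1 else 0]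
    symm
    refine Fintype.sum_of_injective (fun i : Fin (blockStart a j).1 =>
      (⟨i.1, i.2.trans (blockStart a j).2⟩ : Fin n)) (fun i i' h => ?_) _ _ (fun i hi => ?_)
      fun i => ?_
    · exact Fin.ext (congrArg (fun x : Fin n => x.1) h)
    · refine if_neg fun h => hi ⟨⟨i.1, ?_⟩, rfl⟩
      exact (ha.lt_blockStart_iff h.1.le).2 h.2.2
    · have h1 : (⟨i.1, i.2.trans (blockStart a j).2⟩ : Fin n) < blockStart a j := i.2
      have h2 := h1.trans_le hj
      have h3 := (ha.lt_blockStart_iff h2.le).1 h1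
      simp [h2, h3]
  have h1 : Nat.card {j : Fin n // Odd j.1} = ∑ j : Fin n, if Odd j.1 then 1 else 0 := by
    rw [Nat.card_eq_fintype_card, Fintype.card_subtype, Finset.card_filter]
  have h2 : Nat.card (OddInBlock a) =
      ∑ j : Fin n, if Odd (j.1 - (blockStart a j).1) then 1 else 0 := by
    rw [Nat.card_eq_fintype_card, Fintype.card_subtype, Finset.card_filter]
  have h3 : Nat.card (OddPair a) = ∑ j : Fin n, ∑ i ∈ Finset.range (blockStart a j).1,
      if Odd (j.1 - i) then 1 else 0 := by
    rw [Nat.card_eq_fintype_card, Fintype.card_subtype, Finset.card_filter,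
      ← Finset.univ_product_univ, Finset.sum_product_right]
    exact Finset.sum_congr rfl fun j _ => hsum j Odd
  have h4 : Nat.card (DistinctPair a) = (∑ j : Fin n, ∑ i ∈ Finset.range (blockStart a j).1,
      if Odd (j.1 - i) then 1 else 0) + ∑ j : Fin n, ∑ i ∈ Finset.range (blockStart a j).1,
      if Even (j.1 - i) then 1 else 0 := by
    rw [Nat.card_eq_fintype_card, Fintype.card_subtype, Finset.card_filter,
      ← Finset.univ_product_univ, Finset.sum_product_right, ← Finset.sum_add_distrib]
    refine Finset.sum_congr rfl fun j _ => ?_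
    rw [← hsum j Odd, ← hsum j Even, ← Finset.sum_add_distrib]
    refine Finset.sum_congr rfl fun i _ => ?_
    rcases Nat.even_or_odd (j.1 - i.1) with h | h
    · have := Nat.not_odd_iff_even.2 h
      simp [h, this]
    · have := Nat.not_even_iff_odd.2 h
      simp [h, this]
  have h5 := Finset.sum_congr rfl fun (j : Fin n) (_ : j ∈ Finset.univ) =>
    count_parity j.1 (blockStart a j).1 (Fin.le_def.1 (blockStart_le rfl))
  rw [Finset.sum_add_distrib, Finset.sum_add_distrib] at h5
  omega

theorem finrank_so_le : finrank ℝ (so (Fin n) ℝ) ≤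
    finrank ℝ (soA a) + Nat.card (DistinctPair a) := by
  classical
  let T : so (Fin n) ℝ →ₗ[ℝ] DistinctPair a → ℝ :=
    LinearMap.pi fun p => ((LinearMap.proj p.1.2).comp (LinearMap.proj p.1.1)).comp
      (so (Fin n) ℝ).toSubmodule.subtype
  have h1 := T.finrank_range_add_finrank_ker
  have h2 : finrank ℝ (LinearMap.range T) ≤ Fintype.card (DistinctPair a) := by
    simpa using Submodule.finrank_le (LinearMap.range T)
  have h3 : LinearMap.ker T ≤ LinearMap.range (inclA a) := by
    intro X hX
    have h0 : ∀ i j, i < j → a i ≠ a j → X.1 i j = 0 := fun i j hij hne =>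
      congrFun hX ⟨(i, j), hij, hne⟩
    refine ⟨projA a X, Subtype.ext ?_⟩
    ext i j
    change (if a i = a j then X.1 i j else 0) = X.1 i j
    split_ifs with h
    · rfl
    · rcases lt_trichotomy i j with hij | rfl | hij
      · exact (h0 i j hij h).symm
      · exact absurd rfl h
      · rw [skew_apply X j i, h0 j i hij (Ne.symm h), neg_zero]
  have h4 := (Submodule.finrank_mono h3).trans (LinearMap.finrank_range_le (inclA a))
  rw [Nat.card_eq_fintype_card]
  omega

theorem finrank_add_corank_le (ha : IsBlockwise a) :
    finrank ℝ (so (Fin n) ℝ) + corank (so (Fin n) ℝ) ≤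
      2 * Nat.card (OddPair a) + finrank ℝ (soA a) + corank (soA a) := by
  have h1 := card_pairs ha
  have h2 := finrank_so_le (a := a)
  have h3 := corank_so_le (n := n)
  have h4 := card_oddInBlock_le_corank ha
  omega

end Count

/-! ### The Euler equations -/

section Lax

variable {n : ℕ} {a b : Fin n → ℝ}

/-- Lax form with parameter: the hypothesis gives `[M, Ω] = [M + tA, Ω + tB]`, and `tr (X^(k-1) [X,
Y]) = 0`. -/
theorem fderiv_manakovFun_lie {M Ω : so (Fin n) ℝ}
    (h : ⁅diagonal a, Ω.1⁆ = ⁅diagonal b, M.1⁆) (k : ℕ) (t : ℝ) :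
    fderiv ℝ (manakovFun a k t) M ⁅M, Ω⁆ = 0 := by
  have hAB : ⁅diagonal a, diagonal b⁆ = 0 := by
    rw [Ring.lie_def, diagonal_mul_diagonal, diagonal_mul_diagonal, sub_eq_zero]
    simp only [mul_comm]
  have h1 : ⁅M.1, Ω.1⁆ = ⁅M.1 + t • diagonal a, Ω.1 + t • diagonal b⁆ := by
    rw [add_lie, lie_add, lie_add, smul_lie, smul_lie, lie_smul, lie_smul, h, hAB,
      ← lie_skew M.1 (diagonal b), smul_neg, smul_zero, smul_zero]
    abel
  rw [fderiv_manakovFun, LieSubalgebra.coe_bracket, h1, Ring.lie_def, mul_sub, trace_sub,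
    ← mul_assoc, ← mul_assoc, ← pow_succ, trace_mul_comm _ (M.1 + t • diagonal a), ← mul_assoc,
    ← pow_succ', sub_self, mul_zero]

theorem form_weightOp (w : Fin n → Fin n → ℝ) (hw : ∀ i j, w i j = w j i) (X Y : so (Fin n) ℝ) :
    form (so (Fin n) ℝ) (weightOp w hw X) Y = form (so (Fin n) ℝ) X (weightOp w hw Y) := by
  simp only [form_apply, trace, diag_apply, mul_apply, weightOp, LinearMap.coe_mk, AddHom.coe_mk,
    of_apply]
  congr 1
  refine Finset.sum_congr rfl fun i _ => Finset.sum_congr rfl fun j _ => ?_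
  rw [hw j i]
  ring

/-- For `i`, `j` in one block the weights of `(i, l)` and `(l, j)` agree, so the two sums cancel
term by term. -/
theorem projA_lie_weightOp {w : Fin n → Fin n → ℝ} (hw : ∀ i j, w i j = w j i)
    (hwa : ∀ i j l, a i = a j → w i l = w j l) (M : so (Fin n) ℝ) :
    projA a ⁅M, weightOp w hw M⁆ = 0 := by
  refine Subtype.ext (Matrix.ext fun i j => ?_)
  change (if a i = a j then (⁅M, weightOp w hw M⁆ : so (Fin n) ℝ).1 i j else 0) = 0
  split_ifs with h
  · rw [LieSubalgebra.coe_bracket, Ring.lie_def, Matrix.sub_apply, mul_apply, mul_apply,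
      ← Finset.sum_sub_distrib]
    refine Finset.sum_eq_zero fun l _ => ?_
    simp only [weightOp, LinearMap.coe_mk, AddHom.coe_mk, of_apply]
    rw [hw l j, hwa i j l h]
    ring
  · rfl

theorem projA_lie_inclA (M : so (Fin n) ℝ) (Z : soA a) :
    projA a ⁅M, inclA a Z⁆ = ⁅projA a M, Z⁆ := by
  refine form_left_injective fun X => ?_
  rw [← form_inclA, form_lie, form_lie, ← form_inclA]
  rfl

theorem lie_diagonal_soA (X : soA a) {c : Fin n → ℝ} (hc : ∀ i j, a i = a j → c i = c j) :
    ⁅diagonal c, X.1⁆ = 0 := by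
  rw [Ring.lie_def, sub_eq_zero]
  exact (commute_soA_diagonal X hc).symm.eq

end Lax

/-! ### The dimension of the span of the integrals -/

section Span

variable {n : ℕ} {a : Fin n → ℝ}

theorem manakovFun_mem {k : ℕ} (hk : k ∈ Finset.Icc 1 n) (t : ℝ) :
    manakovFun a k t ∈ manakovIntegrals a :=
  ⟨k, hk, t, rfl⟩

theorem exists_eq_manakovFun {f : so (Fin n) ℝ → ℝ} (hf : f ∈ manakovIntegrals a) :
    ∃ k t, f = manakovFun a k t := by
  obtain ⟨k, -, t, rfl⟩ := hf
  exact ⟨k, t, rfl⟩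

theorem bivector_eq_zero_of_mem_span {M : so (Fin n) ℝ} {ξ η : so (Fin n) ℝ}
    (hξ : ξ ∈ gradSpan (manakovIntegrals a) M) (hη : η ∈ gradSpan (manakovIntegrals a) M) :
    bivector M ξ η = 0 := by
  induction hξ, hη using Submodule.span_induction₂ with
  | mem_mem x y hx hy =>
    obtain ⟨f, hf, rfl⟩ := hx
    obtain ⟨g, hg, rfl⟩ := hy
    obtain ⟨k, t, rfl⟩ := exists_eq_manakovFun hf
    obtain ⟨k', t', rfl⟩ := exists_eq_manakovFun hg
    exact poisson_manakovFun M a t t' k k'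
  | zero_left y hy => simp
  | zero_right x hx => simp
  | add_left x y z _ _ _ h1 h2 => rw [map_add, LinearMap.add_apply, h1, h2, add_zero]
  | add_right x y z _ _ _ h1 h2 => rw [map_add, h1, h2, add_zero]
  | smul_left r x y _ _ h => rw [map_smul, LinearMap.smul_apply, h, smul_zero]
  | smul_right r x y _ _ h => rw [map_smul, h, smul_zero]

theorem bivector_inclA_eq_zero_of_mem_span {M : so (Fin n) ℝ} {ξ : so (Fin n) ℝ}
    (hξ : ξ ∈ gradSpan (manakovIntegrals a) M) (X : soA a) :
    bivector M ξ (inclA a X) = 0 := by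
  induction hξ using Submodule.span_induction with
  | mem x hx =>
    obtain ⟨f, hf, rfl⟩ := hx
    obtain ⟨k, t, rfl⟩ := exists_eq_manakovFun hf
    exact bivector_grad_manakovFun_inclA M a t k X
  | zero => simp
  | add x y _ _ h1 h2 => rw [map_add, LinearMap.add_apply, h1, h2, add_zero]
  | smul r x _ h => rw [map_smul, LinearMap.smul_apply, h, smul_zero]

theorem inclA_injective : Function.Injective (inclA a) :=
  Function.LeftInverse.injective (projA_orthogonal a).1

theorem ker_complA : LinearMap.ker (complA a) = LinearMap.range (inclA a) := by
  ext X
  rw [LinearMap.mem_ker, LinearMap.mem_range]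
  constructor
  · intro h
    exact ⟨projA a X, (sub_eq_zero.1 h).symm⟩
  · rintro ⟨Y, rfl⟩
    exact complA_inclA a Y

theorem finrank_map_add_finrank_inf_ker {V W : Type*} [AddCommGroup V] [Module ℝ V]
    [AddCommGroup W] [Module ℝ W] [FiniteDimensional ℝ V] (T : V →ₗ[ℝ] W) (S : Submodule ℝ V) :
    finrank ℝ (S.map T) + finrank ℝ (S ⊓ LinearMap.ker T : Submodule ℝ V) = finrank ℝ S := by
  have h := (T.domRestrict S).finrank_range_add_finrank_ker
  rw [LinearMap.range_domRestrict, LinearMap.ker_domRestrict] at h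
  rw [← h, ← Submodule.map_comap_subtype, Submodule.finrank_map_subtype_eq]

theorem finrank_kerOn {𝔤 : LieSubalgebra ℝ (Matrix (Fin n) (Fin n) ℝ)} (M : 𝔤)
    (V : Submodule ℝ 𝔤) : finrank ℝ (kerOn M V) =
      finrank ℝ (V ⊓ (bivector M).orthogonal V : Submodule ℝ 𝔤) := by
  have h : V ⊓ (bivector M).orthogonal V = (kerOn M V).map V.subtype := by
    ext x
    rw [Submodule.mem_inf, LinearMap.BilinForm.mem_orthogonal_iff, Submodule.mem_map]
    constructor
    · rintro ⟨hx, h⟩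
      refine ⟨⟨x, hx⟩, LinearMap.mem_ker.2 (LinearMap.ext fun y => ?_), rfl⟩
      have : bivector M x y = 0 := by
        rw [bivector_swap, h y y.2, neg_zero]
      exact this
    · rintro ⟨y, hy, rfl⟩
      refine ⟨y.2, fun z hz => ?_⟩
      have : bivector M y z = 0 := LinearMap.congr_fun (LinearMap.mem_ker.1 hy) ⟨z, hz⟩
      change bivector M z y = 0
      rw [bivector_swap, this, neg_zero]
  rw [h, Submodule.finrank_map_subtype_eq]

/-- At generic points, the span of the differentials of the Manakov integrals and of the linear
functions on `so(n)_A` is coisotropic of the expected dimension. -/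
theorem finrank_span_and_kerOn (ha : IsBlockwise a) {M : so (Fin n) ℝ}
    (hM : finrank ℝ (LinearMap.ker (bivector M)) = corank (so (Fin n) ℝ))
    (hL : Nat.card (OddPair a) ≤
      finrank ℝ ((gradSpan (manakovIntegrals a) M).map (complA a))) :
    finrank ℝ (gradSpan (manakovIntegrals a) M ⊔ LinearMap.range (inclA a) : Submodule ℝ _) =
      Nat.card (OddPair a) + finrank ℝ (soA a) ∧
    finrank ℝ (kerOn M (gradSpan (manakovIntegrals a) M ⊔ LinearMap.range (inclA a))) =
      Nat.card (OddPair a) + corank (soA a) ∧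
    finrank ℝ (so (Fin n) ℝ) + corank (so (Fin n) ℝ) =
      2 * Nat.card (OddPair a) + finrank ℝ (soA a) + corank (soA a) := by
  set L := gradSpan (manakovIntegrals a) M with hLdef
  set F := L ⊔ LinearMap.range (inclA a) with hF
  set R := L ⊔ (LinearMap.ker (bivector (projA a M))).map (inclA a) with hR
  have hmap0 : ∀ S : Submodule ℝ (soA a), (S.map (inclA a)).map (complA a) = ⊥ := by
    intro S
    rw [← Submodule.map_comp, show complA a ∘ₗ inclA a = 0 from LinearMap.ext (complA_inclA a),
      Submodule.map_zero]
  have hmapF : F.map (complA a) = L.map (complA a) := by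
    rw [hF, Submodule.map_sup, ← Submodule.map_top, hmap0, sup_bot_eq]
  have hmapR : R.map (complA a) = L.map (complA a) := by
    rw [hR, Submodule.map_sup, hmap0, sup_bot_eq]
  have h1 := finrank_map_add_finrank_inf_ker (complA a) F
  have h2 := finrank_map_add_finrank_inf_ker (complA a) R
  rw [hmapF, ker_complA, inf_eq_right.2 le_sup_right,
    LinearMap.finrank_range_of_inj inclA_injective] at h1
  rw [hmapR, ker_complA] at h2
  -- The corank bounds the kernel dimension at every point, so the projection of `M` need not be
  -- generic.
  have h3 : corank (soA a) ≤
      finrank ℝ (R ⊓ LinearMap.range (inclA a) : Submodule ℝ (so (Fin n) ℝ)) := by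
    refine (corank_le (projA a M)).trans ?_
    rw [(Submodule.equivMapOfInjective (inclA a) inclA_injective _).finrank_eq]
    exact Submodule.finrank_mono (le_inf le_sup_right (LinearMap.map_le_range))
  have h4 : R ≤ F ⊓ (bivector M).orthogonal F := by
    have key : ∀ x ∈ R, ∀ y ∈ F, bivector M x y = 0 := by
      intro x hx y hy
      obtain ⟨x₁, hx₁, x₂, hx₂, rfl⟩ := Submodule.mem_sup.1 hx
      obtain ⟨y₁, hy₁, y₂, hy₂, rfl⟩ := Submodule.mem_sup.1 hy
      obtain ⟨X, hX, rfl⟩ := hx₂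
      obtain ⟨Y, rfl⟩ := hy₂
      have e1 := bivector_eq_zero_of_mem_span hx₁ hy₁
      have e2 := bivector_inclA_eq_zero_of_mem_span hx₁ Y
      have e3 := bivector_inclA_eq_zero_of_mem_span hy₁ X
      rw [bivector_swap, neg_eq_zero] at e3
      have e4 : bivector M (inclA a X) (inclA a Y) = 0 := by
        rw [bivector_inclA, LinearMap.mem_ker.1 hX, LinearMap.zero_apply]
      simp only [map_add, LinearMap.add_apply, e1, e2, e3, e4, add_zero]
    refine le_inf (sup_le_sup_left LinearMap.map_le_range _) fun x hx => ?_
    rw [LinearMap.BilinForm.mem_orthogonal_iff]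
    intro y hy
    change bivector M y x = 0
    rw [bivector_swap, key x hx y hy, neg_zero]
  have hrefl : (bivector M).IsRefl := fun x y h => by
    rw [bivector_swap, h, neg_zero]
  -- `dim F + dim F^⊥ = dim so(n) + dim (F ∩ ker Λ_M)`; with `h4` this bounds `dim F + dim R` above,
  -- and `h9` forces equality throughout.
  have h5 := LinearMap.BilinForm.finrank_add_finrank_orthogonal hrefl F
  have h6 : finrank ℝ (F ⊓ (bivector M).orthogonal ⊤ : Submodule ℝ (so (Fin n) ℝ)) ≤
      corank (so (Fin n) ℝ) := by
    rw [← hM, LinearMap.BilinForm.orthogonal_top_eq_ker hrefl]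
    exact Submodule.finrank_mono inf_le_right
  have h7 := Submodule.finrank_mono h4
  have h8 : finrank ℝ (F ⊓ (bivector M).orthogonal F : Submodule ℝ (so (Fin n) ℝ)) ≤
      finrank ℝ ((bivector M).orthogonal F) := Submodule.finrank_mono inf_le_right
  have h9 := finrank_add_corank_le ha
  rw [finrank_kerOn]
  omega

theorem linearIndependent_sum_elim {V W ι κ : Type*} [AddCommGroup V] [Module ℝ V]
    [AddCommGroup W] [Module ℝ W] [Finite ι] [Finite κ] {v : ι → V} {w : κ → V} (T : V →ₗ[ℝ] W)
    (hv : LinearIndependent ℝ fun i => T (v i)) (hw : LinearIndependent ℝ w)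
    (hTw : ∀ j, T (w j) = 0) : LinearIndependent ℝ (Sum.elim v w) := by
  have := Fintype.ofFinite ι
  have := Fintype.ofFinite κ
  rw [Fintype.linearIndependent_iff]
  intro g hg
  rw [Fintype.sum_sum_type] at hg
  simp only [Sum.elim_inl, Sum.elim_inr] at hg
  have h1 := congrArg T hg
  simp only [map_add, map_sum, map_smul, hTw, smul_zero, Finset.sum_const_zero, add_zero,
    map_zero] at h1
  have h2 := Fintype.linearIndependent_iff.1 hv _ h1
  simp only [h2, zero_smul, Finset.sum_const_zero, zero_add] at hg
  have h3 := Fintype.linearIndependent_iff.1 hw _ hg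
  rintro (i | j)
  · exact h2 i
  · exact h3 j

theorem card_le_finrank_map {M : so (Fin n) ℝ} {κ : OddPair a → ℕ} {τ : OddPair a → ℝ}
    (hκ : ∀ p, κ p ∈ Finset.Icc 1 n)
    (h : LinearIndependent ℝ fun p => complA a (grad (manakovFun a (κ p) (τ p)) M)) :
    Nat.card (OddPair a) ≤ finrank ℝ ((gradSpan (manakovIntegrals a) M).map (complA a)) := by
  classical
  have hmem : ∀ p, complA a (grad (manakovFun a (κ p) (τ p)) M) ∈
      (gradSpan (manakovIntegrals a) M).map (complA a) := fun p =>
    Submodule.mem_map_of_mem (Submodule.subset_span ⟨_, manakovFun_mem (hκ p) _, rfl⟩)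
  have h1 : LinearIndependent ℝ fun p : OddPair a =>
      (⟨_, hmem p⟩ : (gradSpan (manakovIntegrals a) M).map (complA a)) :=
    LinearIndependent.of_comp (Submodule.subtype _) h
  rw [Nat.card_eq_fintype_card]
  exact h1.fintype_card_le_finrank

/-- The Manakov integrals which are generically independent modulo `so(n)_A`. -/
theorem exists_dense_manakovFun (ha : IsBlockwise a) :
    ∃ (κ : OddPair a → ℕ) (τ : OddPair a → ℝ), (∀ p, κ p ∈ Finset.Icc 1 n) ∧
      ∃ U : Set (so (Fin n) ℝ), IsOpen U ∧ Dense U ∧ ∀ M ∈ U,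
        finrank ℝ (LinearMap.ker (bivector M)) = corank (so (Fin n) ℝ) ∧
        LinearIndependent ℝ fun p => complA a (grad (manakovFun a (κ p) (τ p)) M) := by
  obtain ⟨κ, τ, hκ, h⟩ := exists_manakovFun_linearIndependent ha
  obtain ⟨U, hU, hU', hUi⟩ := exists_dense_linearIndependent
    (v := fun p M => complA a (grad (manakovFun a (κ p) (τ p)) M))
    (fun p => (contDiff_of_linear (complA a)).comp (contDiff_grad_manakovFun a _ _)) h
  obtain ⟨V, hV, hV', hVi⟩ := exists_dense_finrank_ker_eq (𝔤 := so (Fin n) ℝ)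
  exact ⟨κ, τ, hκ, U ∩ V, hU.inter hV, hU'.inter_of_isOpen_left hV' hU, fun M hM =>
    ⟨hVi M hM.2, hUi M hM.1⟩⟩

theorem finrank_add_corank_eq (ha : IsBlockwise a) :
    finrank ℝ (so (Fin n) ℝ) + corank (so (Fin n) ℝ) =
      2 * Nat.card (OddPair a) + finrank ℝ (soA a) + corank (soA a) := by
  obtain ⟨κ, τ, hκ, U, -, hU, h⟩ := exists_dense_manakovFun ha
  obtain ⟨M, hM⟩ := hU.nonempty
  exact (finrank_span_and_kerOn ha (h M hM).1 (card_le_finrank_map hκ (h M hM).2)).2.2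

end Span

/-! ### Complete sets -/

section Complete

variable {n : ℕ} {a : Fin n → ℝ}

theorem contDiff_linearMap_soA (φ : soA a →ₗ[ℝ] ℝ) {m : WithTop ℕ∞} :
    ContDiff ℝ m (φ : soA a → ℝ) :=
  contDiff_of_linear φ

theorem fderiv_linear {E : Type*} [NormedAddCommGroup E] [NormedSpace ℝ E] [FiniteDimensional ℝ E]
    (φ : E →ₗ[ℝ] ℝ) (x y : E) : fderiv ℝ φ x y = φ y :=
  congrArg (fun L => L y) φ.toContinuousLinearMap.fderiv

theorem grad_form (X N : soA a) : grad (form (soA a) X) N = X :=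
  grad_eq fun Y => fderiv_linear (form (soA a) X) N Y

theorem isOpen_dense_preimage {E F : Type*} [NormedAddCommGroup E] [NormedSpace ℝ E]
    [FiniteDimensional ℝ E] [NormedAddCommGroup F] [NormedSpace ℝ F] [FiniteDimensional ℝ F]
    {T : E →ₗ[ℝ] F} (hT : Function.Surjective T) {V : Set F} (hV : IsOpen V) (hV' : Dense V) :
    IsOpen (T ⁻¹' V) ∧ Dense (T ⁻¹' V) :=
  ⟨hV.preimage T.continuous_of_finiteDimensional,
    hV'.preimage (T.isOpenMap_of_finiteDimensional hT)⟩

theorem exists_eq_form (φ : soA a →ₗ[ℝ] ℝ) : ∃ X, φ = form (soA a) X :=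
  ⟨((form (soA a)).toDual form_nondegenerate).symm φ, LinearMap.ext fun Y =>
    (LinearMap.BilinForm.apply_toDual_symm_apply φ Y).symm⟩

theorem gradSpan_union_linear (M : so (Fin n) ℝ) :
    gradSpan (manakovIntegrals a ∪ pullbackA a (linearFunctions a)) M =
      gradSpan (manakovIntegrals a) M ⊔ LinearMap.range (inclA a) := by
  apply le_antisymm
  · refine Submodule.span_le.2 ?_
    rintro _ ⟨f, hf | ⟨s, ⟨φ, rfl⟩, rfl⟩, rfl⟩
    · exact Submodule.mem_sup_left (Submodule.subset_span ⟨f, hf, rfl⟩)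
    · refine Submodule.mem_sup_right ?_
      rw [grad_comp_projA (contDiff_linearMap_soA φ)]
      exact ⟨_, rfl⟩
  · refine sup_le (Submodule.span_mono ?_) ?_
    · rintro _ ⟨f, hf, rfl⟩
      exact ⟨f, Or.inl hf, rfl⟩
    · rintro _ ⟨X, rfl⟩
      refine Submodule.subset_span ⟨fun M => form (soA a) X (projA a M),
        Or.inr ⟨_, ⟨form (soA a) X, rfl⟩, rfl⟩, ?_⟩
      rw [grad_comp_projA (contDiff_linearMap_soA _), grad_form]

theorem hasDDimDInd_of_finrank {F : Set (so (Fin n) ℝ → ℝ)} {ι : Type*} [Finite ι]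
    {f : ι → so (Fin n) ℝ → ℝ} (hf : ∀ i, f i ∈ F) {d : ℕ} {U : Set (so (Fin n) ℝ)}
    (hU : IsOpen U) (hU' : Dense U) (h : ∀ M ∈ U, LinearIndependent ℝ (fun i => grad (f i) M) ∧
      finrank ℝ (gradSpan F M) = Nat.card ι ∧ finrank ℝ (kerOn M (gradSpan F M)) = d) :
    HasDDimDInd F (Nat.card ι) d := by
  refine ⟨fun i => f ((Finite.equivFin ι).symm i), fun i => hf _, U, hU, hU', fun M hM => ?_⟩
  obtain ⟨h1, h2, h3⟩ := h M hM
  have h4 : LinearIndependent ℝ fun i => grad (f ((Finite.equivFin ι).symm i)) M :=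
    h1.comp _ (Finite.equivFin ι).symm.injective
  refine ⟨h4, Submodule.eq_of_le_of_finrank_eq (Submodule.span_le.2 ?_) ?_, h3⟩
  · rintro _ ⟨i, rfl⟩
    exact Submodule.subset_span ⟨_, hf _, rfl⟩
  · rw [finrank_span_eq_card h4, Fintype.card_fin, h2]

theorem isCompleteSet_union_linear (ha : IsBlockwise a) :
    IsCompleteSet (manakovIntegrals a ∪ pullbackA a (linearFunctions a)) where
  smooth := by
    rintro f (hf | ⟨s, ⟨φ, rfl⟩, rfl⟩)
    · obtain ⟨k, t, rfl⟩ := exists_eq_manakovFun hf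
      exact contDiff_manakovFun a k t
    · exact contDiff_comp_projA (contDiff_linearMap_soA φ)
  closed := by
    have h0 : ∀ h : so (Fin n) ℝ → ℝ, (∀ M, h M = 0) →
        h ∈ manakovIntegrals a ∪ pullbackA a (linearFunctions a) := fun h hh =>
      Or.inr ⟨_, ⟨0, rfl⟩, funext fun M => by rw [hh M]; rfl⟩
    rintro f (hf | ⟨s, ⟨φ, rfl⟩, rfl⟩) g (hg | ⟨s', ⟨ψ, rfl⟩, rfl⟩)
    · obtain ⟨k, t, rfl⟩ := exists_eq_manakovFun hf
      obtain ⟨k', t', rfl⟩ := exists_eq_manakovFun hg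
      exact h0 _ fun M => poisson_manakovFun M a t t' k k'
    · obtain ⟨k, t, rfl⟩ := exists_eq_manakovFun hf
      exact h0 _ fun M => poisson_manakovFun_comp_projA (contDiff_linearMap_soA ψ) k t M
    · obtain ⟨k, t, rfl⟩ := exists_eq_manakovFun hg
      refine h0 _ fun M => ?_
      rw [poisson_swap, poisson_manakovFun_comp_projA (contDiff_linearMap_soA φ) k t M, neg_zero]
    · obtain ⟨X, rfl⟩ := exists_eq_form φ
      obtain ⟨Y, rfl⟩ := exists_eq_form ψ
      -- Linear functions close under the bracket through the Lie bracket of their gradients.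
      refine Or.inr ⟨_, ⟨-form (soA a) ⁅X, Y⁆, rfl⟩, funext fun M => ?_⟩
      rw [poisson_comp_projA (contDiff_linearMap_soA _) (contDiff_linearMap_soA _), poisson,
        grad_form, grad_form, bivector_apply, form_symm]
      rfl
  complete := by
    obtain ⟨κ, τ, hκ, U, hU, hU', h⟩ := exists_dense_manakovFun ha
    let b := finBasis ℝ (soA a)
    let f : OddPair a ⊕ Fin (finrank ℝ (soA a)) → so (Fin n) ℝ → ℝ :=
      Sum.elim (fun p => manakovFun a (κ p) (τ p)) fun i M => form (soA a) (b i) (projA a M)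
    refine ⟨_, Nat.card (OddPair a) + corank (soA a), hasDDimDInd_of_finrank (f := f) ?_ hU hU'
      fun M hM => ?_, ?_⟩
    · rintro (p | i)
      · exact Or.inl (manakovFun_mem (hκ p) _)
      · exact Or.inr ⟨_, ⟨form (soA a) (b i), rfl⟩, rfl⟩
    · obtain ⟨h1, h2, -⟩ := finrank_span_and_kerOn ha (h M hM).1
        (card_le_finrank_map hκ (h M hM).2)
      rw [gradSpan_union_linear]
      refine ⟨?_, ?_, h2⟩
      · have h3 : (fun i => grad (f i) M) = Sum.elim
            (fun p => grad (manakovFun a (κ p) (τ p)) M) fun i => inclA a (b i) := by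
          funext i
          rcases i with p | i
          · rfl
          · change grad (fun M => form (soA a) (b i) (projA a M)) M = _
            rw [grad_comp_projA (contDiff_linearMap_soA _), grad_form]
            rfl
        rw [h3]
        exact linearIndependent_sum_elim (complA a) (h M hM).2
          (b.linearIndependent.map' (inclA a) (LinearMap.ker_eq_bot.2 inclA_injective))
          fun i => complA_inclA a _
      · rw [h1, Nat.card_sum, Nat.card_fin]
    · rw [finrank_add_corank_eq ha, Nat.card_sum, Nat.card_fin]
      ring

theorem isCompleteCommutingSet_union (ha : IsBlockwise a) {S : Set (soA a → ℝ)}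
    (hS : IsCompleteCommutingSet S) :
    IsCompleteCommutingSet (manakovIntegrals a ∪ pullbackA a S) where
  smooth := by
    rintro f (hf | ⟨s, hs, rfl⟩)
    · obtain ⟨k, t, rfl⟩ := exists_eq_manakovFun hf
      exact contDiff_manakovFun a k t
    · exact contDiff_comp_projA (hS.smooth s hs)
  comm := by
    rintro f (hf | ⟨s, hs, rfl⟩) g (hg | ⟨s', hs', rfl⟩) M
    · obtain ⟨k, t, rfl⟩ := exists_eq_manakovFun hf
      obtain ⟨k', t', rfl⟩ := exists_eq_manakovFun hg
      exact poisson_manakovFun M a t t' k k'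
    · obtain ⟨k, t, rfl⟩ := exists_eq_manakovFun hf
      exact poisson_manakovFun_comp_projA (hS.smooth s' hs') k t M
    · obtain ⟨k, t, rfl⟩ := exists_eq_manakovFun hg
      rw [poisson_swap, poisson_manakovFun_comp_projA (hS.smooth s hs) k t M, neg_zero]
    · rw [poisson_comp_projA (hS.smooth s hs) (hS.smooth s' hs'), hS.comm s hs s' hs']
  complete := by
    obtain ⟨κ, τ, hκ, U, hU, hU', h⟩ := exists_dense_manakovFun ha
    obtain ⟨q, s, hq, hsS, V, hV, hV', hVi⟩ := hS.complete
    let f : OddPair a ⊕ Fin q → so (Fin n) ℝ → ℝ :=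
      Sum.elim (fun p => manakovFun a (κ p) (τ p)) fun i M => s i (projA a M)
    have hmem : ∀ i, f i ∈ manakovIntegrals a ∪ pullbackA a S := by
      rintro (p | i)
      · exact Or.inl (manakovFun_mem (hκ p) _)
      · exact Or.inr ⟨_, hsS i, rfl⟩
    -- The projection is surjective, hence open, so generic points of `so(n)_A` pull back to generic
    -- points.
    obtain ⟨hW, hW'⟩ := isOpen_dense_preimage (T := projA a)
      (fun X => ⟨_, (projA_orthogonal a).1 X⟩) hV hV'
    refine ⟨Nat.card (OddPair a ⊕ Fin q), fun i => f ((Finite.equivFin _).symm i), ?_,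
      fun i => hmem _, U ∩ projA a ⁻¹' V, hU.inter hW, hU'.inter_of_isOpen_left hW' hU, fun M hM => ?_⟩
    · rw [finrank_add_corank_eq ha, Nat.card_sum, Nat.card_fin]
      omega
    · have h3 : (fun i => grad (f i) M) = Sum.elim
          (fun p => grad (manakovFun a (κ p) (τ p)) M) fun i => inclA a (grad (s i) (projA a M)) := by
        funext i
        rcases i with p | i
        · rfl
        · exact grad_comp_projA (hS.smooth _ (hsS i)) M
      have h4 : LinearIndependent ℝ fun i => grad (f i) M := by
        rw [h3]
        exact linearIndependent_sum_elim (complA a) (h M hM.1).2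
          ((hVi _ hM.2).map' (inclA a) (LinearMap.ker_eq_bot.2 inclA_injective))
          fun i => complA_inclA a _
      exact h4.comp _ (Finite.equivFin _).symm.injective

end Complete

/-! ### Block entries -/

section Blocks

variable {r : ℕ} (k : Fin r → ℕ)

/-- A position is the total length of the earlier blocks plus an offset smaller than its own block.
-/
theorem finSigmaFinEquiv_symm_fst_mono {i j : Fin (∑ s, k s)} (hij : i ≤ j) :
    (finSigmaFinEquiv.symm i).1 ≤ (finSigmaFinEquiv.symm j).1 := by
  by_contra hlt
  rw [not_le] at hlt
  obtain ⟨x, rfl⟩ := finSigmaFinEquiv.surjective i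
  obtain ⟨y, rfl⟩ := finSigmaFinEquiv.surjective j
  rw [Equiv.symm_apply_apply, Equiv.symm_apply_apply] at hlt
  rw [Fin.le_def, finSigmaFinEquiv_apply, finSigmaFinEquiv_apply] at hij
  have hpre : ∀ s : Fin r, ∑ i : Fin s.1, k (Fin.castLE s.2.le i) = ∑ i ∈ Finset.Iio s, k i := by
    intro s
    refine Finset.sum_bij (fun i _ => Fin.castLE s.2.le i) (fun i _ => ?_) (fun i _ i' _ h => ?_)
      (fun i hi => ?_) fun i _ => rfl
    · rw [Finset.mem_Iio]
      exact i.2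
    · exact Fin.castLE_injective _ h
    · exact ⟨⟨i.1, Fin.lt_def.1 (Finset.mem_Iio.1 hi)⟩, Finset.mem_univ _, rfl⟩
  rw [hpre, hpre] at hij
  have h1 : ∑ i ∈ Finset.Iic y.1, k i ≤ ∑ i ∈ Finset.Iio x.1, k i := by
    refine Finset.sum_le_sum_of_subset fun i hi => ?_
    rw [Finset.mem_Iio]
    exact (Finset.mem_Iic.1 hi).trans_lt hlt
  rw [← Finset.Iio_insert, Finset.sum_insert (by simp)] at h1
  have h2 := y.2.2
  omega

variable {k}

theorem isBlockwise_blockEntries {α : Fin r → ℝ} (hα : Function.Injective α) :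
    IsBlockwise (blockEntries k α) := by
  intro i j l hij hjl h
  have h1 : (finSigmaFinEquiv.symm i).1 = (finSigmaFinEquiv.symm l).1 := hα h
  have h2 := finSigmaFinEquiv_symm_fst_mono k hij
  have h3 := finSigmaFinEquiv_symm_fst_mono k hjl
  exact congrArg α (le_antisymm (h3.trans h1.ge) h2)

theorem blockEntries_congr {α : Fin r → ℝ} (hα : Function.Injective α) (β : Fin r → ℝ)
    (i j : Fin (∑ s, k s)) (h : blockEntries k α i = blockEntries k α j) :
    blockEntries k β i = blockEntries k β j :=
  congrArg β (hα h)

end Blocks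

/-! ### The rigid body with `A = B²`. -/

section Sq

variable {n : ℕ} {b : Fin n → ℝ}

theorem eq_of_sq_eq (hb : ∀ i j, i ≠ j → b i + b j ≠ 0) (i j : Fin n) (h : b i ^ 2 = b j ^ 2) :
    b i = b j := by
  rcases eq_or_ne i j with rfl | hij
  · rfl
  · have h1 : (b i + b j) * (b i - b j) = 0 := by linear_combination h
    exact sub_eq_zero.1 ((mul_eq_zero.1 h1).resolve_left (hb i j hij))

theorem isBlockwise_sq (hb : ∀ i j, i ≠ j → b i + b j ≠ 0) (h : IsBlockwise b) :
    IsBlockwise fun i => b i ^ 2 := fun i j l hij hjl hil => by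
  dsimp only at hil ⊢
  rw [h i j l hij hjl (eq_of_sq_eq hb i l hil)]

theorem lie_rigidBodyOp (hb : ∀ i j, i ≠ j → b i + b j ≠ 0) (M : so (Fin n) ℝ) :
    ⁅diagonal fun i => b i ^ 2, (rigidBodyOp b M).1⁆ = ⁅diagonal b, M.1⁆ := by
  ext i j
  rw [Ring.lie_def, Ring.lie_def, Matrix.sub_apply, Matrix.sub_apply, mul_diagonal,
    diagonal_mul, mul_diagonal, diagonal_mul]
  simp only [rigidBodyOp, weightOp, LinearMap.coe_mk, AddHom.coe_mk, of_apply]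
  rcases eq_or_ne i j with rfl | hij
  -- On the diagonal `b i + b i` may be zero, but both commutators have zero diagonal there.
  · ring
  · have := hb i j hij
    field_simp
    ring

end Sq

end Manakov

/-! ### The integrability theorem. -/

theorem corollary1 {r : ℕ} (k : Fin r → ℕ) (β : Fin r → ℝ) (hβ : Function.Injective β) :
    ((∀ i j, i ≠ j → blockEntries k β i + blockEntries k β j ≠ 0) →
      NoncommutativelyIntegrableBy (euler (rigidBodyOp (blockEntries k β)))
        (manakovIntegrals (fun i => blockEntries k β i ^ 2) ∪
          pullbackA (fun i => blockEntries k β i ^ 2)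
            (linearFunctions (fun i => blockEntries k β i ^ 2)))) ∧
    ∀ α : Fin r → ℝ, Function.Injective α →
      ∀ 𝔅 : soA (blockEntries k α) →ₗ[ℝ] soA (blockEntries k α), IsPosDefOp 𝔅 →
        IsPosDefOp (manakovOp (blockEntries k α) (blockEntries k β) 𝔅) →
        ∀ S₀ : Set (soA (blockEntries k α) → ℝ), LiouvilleIntegrableBy (euler 𝔅) S₀ →
          LiouvilleIntegrableBy (euler (manakovOp (blockEntries k α) (blockEntries k β) 𝔅))
            (manakovIntegrals (blockEntries k α) ∪ pullbackA (blockEntries k α) S₀) := by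
  constructor
  · intro hb
    have hT := form_weightOp (fun i j => 1 / (blockEntries k β i + blockEntries k β j))
      (fun i j => by rw [add_comm])
    refine ⟨energy (rigidBodyOp (blockEntries k β)), isHamiltonianSystem_euler hT, ?_,
      isCompleteSet_union_linear (isBlockwise_sq hb (isBlockwise_blockEntries hβ))⟩
    rintro f (hf | ⟨s, ⟨φ, rfl⟩, rfl⟩) M
    · obtain ⟨l, t, rfl⟩ := exists_eq_manakovFun hf
      exact (poisson_energy hT _ M).trans (fderiv_manakovFun_lie (lie_rigidBodyOp hb M) l t)
    · refine (poisson_energy hT _ M).trans ?_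
      -- The weights depend only on the blocks, so `M_{so(n)_A}` is a constant of motion.
      have h0 : projA (fun i => blockEntries k β i ^ 2)
          (euler (rigidBodyOp (blockEntries k β)) M) = 0 :=
        projA_lie_weightOp _ (fun i j l h => by rw [eq_of_sq_eq hb i j h]) M
      rw [fderiv_comp_projA (contDiff_linearMap_soA φ)]
      exact (congrArg _ h0).trans (map_zero _)
  · intro α hα 𝔅 h𝔅 h𝔄 S₀ hS₀
    obtain ⟨H, hH, hHS, hS⟩ := hS₀
    refine ⟨energy (manakovOp (blockEntries k α) (blockEntries k β) 𝔅),
      isHamiltonianSystem_euler h𝔄.1, ?_,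
      isCompleteCommutingSet_union (isBlockwise_blockEntries hα) hS⟩
    have hab := blockEntries_congr (k := k) hα β
    rintro f (hf | ⟨s, hs, rfl⟩) M
    · obtain ⟨l, t, rfl⟩ := exists_eq_manakovFun hf
      refine (poisson_energy h𝔄.1 _ M).trans (fderiv_manakovFun_lie
        (b := blockEntries k β) ?_ l t)
      have h1 := (adInvAd_spec (blockEntries k α) (blockEntries k β) M).1
      have h2 := lie_diagonal_soA (𝔅 (projA (blockEntries k α) M)) fun i j h => h
      have h3 := lie_diagonal_soA (projA (blockEntries k α) M) hab
      change ⁅_, (adInvAd (blockEntries k α) (blockEntries k β) M).1 +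
        (𝔅 (projA (blockEntries k α) M)).1⁆ = _
      rw [lie_add, h1, h2, add_zero]
      change ⁅_, M.1 - (projA (blockEntries k α) M).1⁆ = _
      rw [lie_sub, h3, sub_zero]
    · refine (poisson_energy h𝔄.1 _ M).trans ?_
      -- The projection intertwines the Manakov flow with the reduced system, so integrals of the
      -- latter, whatever its Hamiltonian `H`, are conserved.
      have h0 : projA (blockEntries k α)
          (euler (manakovOp (blockEntries k α) (blockEntries k β) 𝔅) M) =
            euler 𝔅 (projA (blockEntries k α) M) := by
        change projA _ ⁅M, adInvAd _ _ M + inclA _ (𝔅 (projA _ M))⁆ = _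
        rw [lie_add, map_add, projA_lie_inclA]
        have h4 : projA (blockEntries k α)
            ⁅M, adInvAd (blockEntries k α) (blockEntries k β) M⁆ = 0 :=
          projA_lie_weightOp _ (fun i j l h => by rw [h, hab i j h]) M
        rw [h4, zero_add]
        rfl
      rw [fderiv_comp_projA (hS.smooth s hs), h0, hH.2 s (hS.smooth s hs)]
      exact hHS s hs _
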